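/- There is an absolute constant $C>0$ such that the following holds. Let $M\in[0,1]^{m\times n}$ be a matrix game with $1\le m\le n$ and $n\ge 2$ (entries are losses of the row player, who minimizes, and rewards of the column player, who maximizes), let $\varepsilon>0$, and let $$\beta=\frac{2+\sqrt{2\ln n}}{\varepsilon\sqrt{8\ln n}} .$$ Stochastic Fictitious Play (SFP) with initial pure strategies $k\in[m]$, $l\in[n]$ and perturbations from the Gumbel distribution $G(0,\beta)$ (distribution function $x\mapsto e^{-e^{-x/\beta}}$) is the following procedure. Start with $t=1$, $p=e_k\in\mathbb R^m$, $q=e_l\in\mathbb R^n$. While $$\max_{j}(p^\top M)_j-\min_{i}(Mq)_i>t\,\varepsilon ,$$ perform an iteration: draw random vectors $u\in\mathbb R^m$, $v\in\mathbb R^n$ whose components are i.i.d. with law $G(0,\beta)$, independent of everything drawn before; choose $i\in\arg\min_{i'}(Mq-u)_{i'}$ and $j\in\arg\max_{j'}(p^\top M+v)_{j'}$ (ties broken by any fixed measurable rule); replace $t,p,q$ by $t+1$, $p+e_i$, $q+e_j$. When the loop ends, return $(p/t,q/t)$. For all initial strategies $k,l$: 1. SFP terminates almost surely, it returns an $\varepsilon$-Nash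 equilibrium $(p^*,q^*)$ of $M$, that is, mixed strategies with $p^{*\top}Mq^*-\min_i(Mq^*)_i\le\varepsilon$ and $\max_j(p^{*\top}M)_j-p^{*\top}Mq^*\le\varepsilon$, and its expected number of iterations is at most $C\,\frac{\ln n}{\varepsilon^2}$. 2. The same holds for SFP with restarts: independent runs of SFP (all started from $k,l$) are executed one after another, each of them cut off after $\left\lceil\left(\frac{2+\sqrt{2\ln n}}{\varepsilon}\right)^2\right\rceil$ iterations, until one run terminates by itself. Almost surely some run does so, the pair that it returns is an $\varepsilon$-Nash equilibrium of $M$, and the expected total number of iterations is at most $C\,\frac{\ln n}{\varepsilon^2}$. -/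

import Mathlib

open MeasureTheory ProbabilityTheory Set Filter Topology
open scoped Matrix ENNReal

/-! ### Gumbel distribution -/

/-- Density of the Gumbel distribution with location `μ` and scale `β > 0`. -/
noncomputable def gumbelPDFReal (μ β x : ℝ) : ℝ :=
  β⁻¹ * (Real.exp (-(x - μ) / β) * Real.exp (-Real.exp (-(x - μ) / β)))

/-- The Gumbel distribution `G(μ, β)`. For `β > 0` it is the probability measure with
distribution function `exp (-exp (-(x - μ) / β))`, see `gumbelMeasure_Iic`. -/
noncomputable def gumbelMeasure (μ β : ℝ) : Measure ℝ :=
  volume.withDensity fun x => ENNReal.ofReal (gumbelPDFReal μ β x)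

theorem gumbel_hasDerivAt (μ β x : ℝ) :
    HasDerivAt (fun y : ℝ => Real.exp (-Real.exp (-(y - μ) / β))) (gumbelPDFReal μ β x) x := by
  have h1 : HasDerivAt (fun y : ℝ => -(y - μ) / β) (-1 / β) x :=
    (((hasDerivAt_id x).sub_const μ).neg).div_const β
  have h2 : HasDerivAt (fun y : ℝ => Real.exp (-Real.exp (-(y - μ) / β)))
      (Real.exp (-Real.exp (-(x - μ) / β)) * -(Real.exp (-(x - μ) / β) * (-1 / β))) x :=
    (h1.exp.neg).exp
  refine h2.congr_deriv ?_
  unfold gumbelPDFReal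
  ring

theorem gumbelPDFReal_nonneg {β : ℝ} (hβ : 0 < β) (μ x : ℝ) : 0 ≤ gumbelPDFReal μ β x := by
  unfold gumbelPDFReal
  positivity

theorem gumbel_tendsto_atBot {β : ℝ} (hβ : 0 < β) (μ : ℝ) :
    Tendsto (fun y : ℝ => Real.exp (-Real.exp (-(y - μ) / β))) atBot (𝓝 0) := by
  refine Real.tendsto_exp_atBot.comp (tendsto_neg_atTop_atBot.comp
    (Real.tendsto_exp_atTop.comp (Tendsto.atTop_div_const hβ (tendsto_neg_atBot_atTop.comp ?_))))
  simpa [sub_eq_add_neg] using tendsto_atBot_add_const_right atBot (-μ) tendsto_id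

theorem gumbel_tendsto_atTop {β : ℝ} (hβ : 0 < β) (μ : ℝ) :
    Tendsto (fun y : ℝ => Real.exp (-Real.exp (-(y - μ) / β))) atTop (𝓝 1) := by
  have h : Tendsto (fun y : ℝ => Real.exp (-(y - μ) / β)) atTop (𝓝 0) := by
    refine Real.tendsto_exp_atBot.comp (Tendsto.atBot_div_const hβ
      (tendsto_neg_atTop_atBot.comp ?_))
    simpa [sub_eq_add_neg] using tendsto_atTop_add_const_right atTop (-μ) tendsto_id
  simpa [Function.comp_def] using (Real.continuous_exp.tendsto _).comp h.neg

theorem gumbelPDFReal_integrable {β : ℝ} (hβ : 0 < β) (μ : ℝ) :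
    Integrable (gumbelPDFReal μ β) := by
  have hc : Continuous (gumbelPDFReal μ β) := by
    unfold gumbelPDFReal
    fun_prop
  refine integrable_of_intervalIntegral_norm_bounded (l := atTop)
    (a := fun r : ℝ => -r) (b := fun r : ℝ => r) 1
    (fun r => (hc.integrableOn_Icc).mono_set Ioc_subset_Icc_self)
    tendsto_neg_atTop_atBot tendsto_id (Eventually.of_forall fun r => ?_)
  have h1 : ∀ x, ‖gumbelPDFReal μ β x‖ = gumbelPDFReal μ β x := fun x =>
    Real.norm_of_nonneg (gumbelPDFReal_nonneg hβ μ x)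
  simp only [h1]
  rw [intervalIntegral.integral_eq_sub_of_hasDerivAt
    (fun x _ => gumbel_hasDerivAt μ β x) (hc.intervalIntegrable _ _)]
  have h2 : Real.exp (-Real.exp (-(r - μ) / β)) ≤ 1 :=
    Real.exp_le_one_iff.2 (neg_nonpos.2 (Real.exp_pos _).le)
  have h3 := Real.exp_pos (-Real.exp (-(-r - μ) / β))
  linarith

theorem gumbelMeasure_Iic {β : ℝ} (hβ : 0 < β) (μ x : ℝ) :
    gumbelMeasure μ β (Iic x) = ENNReal.ofReal (Real.exp (-Real.exp (-(x - μ) / β))) := by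
  rw [gumbelMeasure, withDensity_apply _ measurableSet_Iic,
    ← ofReal_integral_eq_lintegral_ofReal (gumbelPDFReal_integrable hβ μ).integrableOn
      (Eventually.of_forall fun y => gumbelPDFReal_nonneg hβ μ y),
    integral_Iic_of_hasDerivAt_of_tendsto' (fun y _ => gumbel_hasDerivAt μ β y)
      (gumbelPDFReal_integrable hβ μ).integrableOn (gumbel_tendsto_atBot hβ μ), sub_zero]

theorem isProbabilityMeasure_gumbelMeasure {β : ℝ} (hβ : 0 < β) (μ : ℝ) :
    IsProbabilityMeasure (gumbelMeasure μ β) := by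
  constructor
  rw [gumbelMeasure, withDensity_apply _ MeasurableSet.univ, Measure.restrict_univ,
    ← ofReal_integral_eq_lintegral_ofReal (gumbelPDFReal_integrable hβ μ)
      (Eventually.of_forall fun y => gumbelPDFReal_nonneg hβ μ y),
    integral_of_hasDerivAt_of_tendsto (fun y => gumbel_hasDerivAt μ β y)
      (gumbelPDFReal_integrable hβ μ) (gumbel_tendsto_atBot hβ μ) (gumbel_tendsto_atTop hβ μ)]
  simp

/-- The perturbation vectors `u a ∈ ℝ^m` and `v a ∈ ℝ^n`, `a` ranging over an index set `κ` of
oracle calls, have all their components independent with law `G(0, β)`. -/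
structure IsGumbelPerturbation {Ω κ : Type*} [MeasurableSpace Ω] {m n : ℕ} (β : ℝ)
    (u : κ → Ω → Fin m → ℝ) (v : κ → Ω → Fin n → ℝ) (P : Measure Ω) : Prop where
  law_row : ∀ a i, HasLaw (fun ω => u a ω i) (gumbelMeasure 0 β) P
  law_col : ∀ a j, HasLaw (fun ω => v a ω j) (gumbelMeasure 0 β) P
  indep : iIndepFun
    (fun (x : κ × (Fin m ⊕ Fin n)) (ω : Ω) => Sum.elim (u x.1 ω) (v x.1 ω) x.2) P

/-! ### Matrix games: entries are losses of the row player, rewards of the column player -/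

/-- Best-response value of the row player (the minimum over the rows). -/
noncomputable def brValRow {m n : ℕ} (M : Matrix (Fin m) (Fin n) ℝ) (q : Fin n → ℝ) : ℝ :=
  ⨅ i, (M *ᵥ q) i

/-- Best-response value of the column player (the maximum over the columns). -/
noncomputable def brValCol {m n : ℕ} (M : Matrix (Fin m) (Fin n) ℝ) (p : Fin m → ℝ) : ℝ :=
  ⨆ j, (p ᵥ* M) j

/-- `(p, q)` is an `ε`-Nash equilibrium, in mixed strategies, of the matrix game `M`. -/
def IsEpsNash {m n : ℕ} (M : Matrix (Fin m) (Fin n) ℝ) (ε : ℝ)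
    (p : Fin m → ℝ) (q : Fin n → ℝ) : Prop :=
  p ∈ stdSimplex ℝ (Fin m) ∧ q ∈ stdSimplex ℝ (Fin n) ∧
    p ⬝ᵥ (M *ᵥ q) - brValRow M q ≤ ε ∧ brValCol M p - p ⬝ᵥ (M *ᵥ q) ≤ ε

/-- `f` picks an index of a minimal entry (any measurable rule for breaking ties). -/
def IsArgminRule {d : ℕ} (f : (Fin d → ℝ) → Fin d) : Prop :=
  Measurable f ∧ ∀ (x : Fin d → ℝ) (i : Fin d), x (f x) ≤ x i

/-- `g` picks an index of a maximal entry (any measurable rule for breaking ties). -/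
def IsArgmaxRule {d : ℕ} (g : (Fin d → ℝ) → Fin d) : Prop :=
  Measurable g ∧ ∀ (x : Fin d → ℝ) (i : Fin d), x i ≤ x (g x)

/-! ### Stochastic Fictitious Play -/

/-- The variables of Stochastic Fictitious Play: the counter `t` and the vectors `p`, `q` of
multiplicities of the pure strategies played so far. -/
structure SFPState (m n : ℕ) where
  t : ℕ
  p : Fin m → ℝ
  q : Fin n → ℝ

/-- Initialization with the pure strategies `k`, `l`. -/
def sfpInit {m n : ℕ} (k : Fin m) (l : Fin n) : SFPState m n :=
  ⟨1, Pi.single k 1, Pi.single l 1⟩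

/-- The body of the loop: each player adds a perturbed best response to the other player's
current vector, the perturbations being `u` and `v`. -/
def sfpStep {m n : ℕ} (M : Matrix (Fin m) (Fin n) ℝ)
    (f : (Fin m → ℝ) → Fin m) (g : (Fin n → ℝ) → Fin n)
    (u : Fin m → ℝ) (v : Fin n → ℝ) (s : SFPState m n) : SFPState m n :=
  ⟨s.t + 1, s.p + Pi.single (f (M *ᵥ s.q - u)) 1, s.q + Pi.single (g (s.p ᵥ* M + v)) 1⟩

/-- The state after `N` executions of the loop body, the `N`-th (from `0`) using the
perturbations `u N`, `v N`; the loop guard is not taken into account here. -/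
def sfpState {m n : ℕ} (M : Matrix (Fin m) (Fin n) ℝ)
    (f : (Fin m → ℝ) → Fin m) (g : (Fin n → ℝ) → Fin n) (k : Fin m) (l : Fin n)
    (u : ℕ → Fin m → ℝ) (v : ℕ → Fin n → ℝ) : ℕ → SFPState m n
  | 0 => sfpInit k l
  | N + 1 => sfpStep M f g (u N) (v N) (sfpState M f g k l u v N)

/-- The guard `ub - lb > t ε` of the loop fails. -/
def sfpDone {m n : ℕ} (M : Matrix (Fin m) (Fin n) ℝ) (ε : ℝ) (s : SFPState m n) : Prop :=
  brValCol M s.p - brValRow M s.q ≤ s.t * ε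

/-- Number of iterations of the loop that Stochastic Fictitious Play executes before it
terminates (`⊤` if it never does). -/
noncomputable def sfpIterations {m n : ℕ} (M : Matrix (Fin m) (Fin n) ℝ) (ε : ℝ)
    (f : (Fin m → ℝ) → Fin m) (g : (Fin n → ℝ) → Fin n) (k : Fin m) (l : Fin n)
    (u : ℕ → Fin m → ℝ) (v : ℕ → Fin n → ℝ) : ℕ∞ :=
  ⨅ (N : ℕ) (_ : sfpDone M ε (sfpState M f g k l u v N)), (N : ℕ∞)

/-- Normalized vector of the row player after `N` iterations. -/
noncomputable def sfpRow {m n : ℕ} (M : Matrix (Fin m) (Fin n) ℝ)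
    (f : (Fin m → ℝ) → Fin m) (g : (Fin n → ℝ) → Fin n) (k : Fin m) (l : Fin n)
    (u : ℕ → Fin m → ℝ) (v : ℕ → Fin n → ℝ) (N : ℕ) : Fin m → ℝ :=
  ((sfpState M f g k l u v N).t : ℝ)⁻¹ • (sfpState M f g k l u v N).p

/-- Normalized vector of the column player after `N` iterations. -/
noncomputable def sfpCol {m n : ℕ} (M : Matrix (Fin m) (Fin n) ℝ)
    (f : (Fin m → ℝ) → Fin m) (g : (Fin n → ℝ) → Fin n) (k : Fin m) (l : Fin n)
    (u : ℕ → Fin m → ℝ) (v : ℕ → Fin n → ℝ) (N : ℕ) : Fin n → ℝ :=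
  ((sfpState M f g k l u v N).t : ℝ)⁻¹ • (sfpState M f g k l u v N).q

open Classical in
/-- Total number of iterations when runs `0, 1, 2, …`, where run `r` would terminate by itself
after `τ r` iterations, are executed one after another, each of them cut off after `T`
iterations, until one of them terminates by itself: run `r` is executed if and only if all
earlier runs were cut off, and then it takes `min (τ r) T` iterations. -/
noncomputable def restartedIterations (T : ℕ) (τ : ℕ → ℕ∞) : ℝ≥0∞ :=
  ∑' r : ℕ, if ∀ s < r, (T : ℕ∞) < τ s then ((min (τ r) T : ℕ∞) : ℝ≥0∞) else 0

/-- The scale parameter of the Gumbel perturbations. -/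
noncomputable def sfpScale (n : ℕ) (ε : ℝ) : ℝ :=
  (2 + √(2 * Real.log n)) / (ε * √(8 * Real.log n))

/-- The number of iterations after which a run is cut off in the variant with restarts. -/
noncomputable def sfpCutoff (n : ℕ) (ε : ℝ) : ℕ :=
  ⌈((2 + √(2 * Real.log n)) / ε) ^ 2⌉₊

/-! By the Gumbel trick, a perturbed best response is a sample from the softmax of the payoffs at
scale `β`, so SFP is a pair of sampled exponential-weights players. Let `x`, `y` be the softmax
weights of `-(M *ᵥ q)` and `p ᵥ* M`. The potential is the product of the two partition functions,
raised to a power `θ`. One step changes its logarithm to first order by `θ/β` times (row `i` of `M`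
averaged over `y`, minus column `j` averaged over `x`). Since `i` has law `x` and `j` has law `y`,
independently given the past, both averages have mean `xᵀMy` and cancel. Two uses of Hoeffding's
lemma, one inside the partition functions and one over the random choices, bound the remaining
growth by `exp (θ/(4β²) + (θ/β)²/4)` per step (`sum_sum_softmax_mul_sfpPotential_le`).

If the guard holds after `N` iterations, the potential exceeds `exp (θ/β * (N+1) ε)`. Markov's
inequality then gives an exponential tail (`measure_not_sfpDone_le`). With `R = (2 + √(2 log n))/ε`
and `θ = 2/√(2 log n)`, the tail is at most `exp (-2N/R²)` once `N ≥ R²` (`sfp_exponent_le`).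
Summing it bounds the expected number of iterations by a multiple of `R²`, and Borel–Cantelli gives
termination. With restarts, each run fails at the cutoff with probability at most `1/2`,
independently of the others, so the expected number of runs is at most `2`. When the guard fails,
the normalized duality gap is at most `ε`, which bounds both regrets. -/

/-- **Hoeffding's lemma** for a finite probability vector. -/
theorem sum_mul_exp_le_of_mem_Icc {ι : Type*} [Fintype ι] {w : ι → ℝ}
    (hw : w ∈ stdSimplex ℝ ι) {z : ι → ℝ} (hz : ∀ i, z i ∈ Set.Icc (0 : ℝ) 1) (t : ℝ) :
    ∑ i, w i * Real.exp (t * z i) ≤ Real.exp (t * ∑ i, w i * z i + t ^ 2 / 8) := by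
  let _ : MeasurableSpace ι := ⊤
  let μ : Measure ι := ∑ i, ENNReal.ofReal (w i) • Measure.dirac i
  have hint : ∀ F : ι → ℝ, ∫ i, F i ∂μ = ∑ i, w i * F i := fun F => by
    rw [integral_finsetSum_measure]
    · refine Finset.sum_congr rfl fun i _ => ?_
      rw [integral_smul_measure, integral_dirac, ENNReal.toReal_ofReal (hw.1 i), smul_eq_mul]
    · exact fun i _ => (integrable_dirac (by simp)).smul_measure ENNReal.ofReal_ne_top
  have : IsProbabilityMeasure μ := ⟨by
    simp only [μ, Measure.coe_finsetSum, Finset.sum_apply, Measure.smul_apply, measure_univ,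
      smul_eq_mul, mul_one]
    rw [← ENNReal.ofReal_sum_of_nonneg fun i _ => hw.1 i, hw.2, ENNReal.ofReal_one]⟩
  have h := (hasSubgaussianMGF_of_mem_Icc (μ := μ) (X := z)
    (measurable_from_top.aemeasurable) (ae_of_all _ hz)).mgf_le t
  rw [mgf, hint, hint] at h
  have e : ∀ i, w i * Real.exp (t * z i)
      = Real.exp (t * ∑ i, w i * z i) * (w i * Real.exp (t * (z i - ∑ i, w i * z i))) := fun i => by
    rw [mul_left_comm, ← Real.exp_add]
    ring_nf
  rw [Finset.sum_congr rfl fun i _ => e i, ← Finset.mul_sum, Real.exp_add]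
  refine mul_le_mul_of_nonneg_left (h.trans_eq ?_) (Real.exp_pos _).le
  congr 1
  norm_num
  ring

/-! ### Gibbs weights -/

/-- The partition function of the Gibbs weights `exp (a i / β)`. -/
noncomputable def sumExp {ι : Type*} [Fintype ι] (β : ℝ) (a : ι → ℝ) : ℝ :=
  ∑ i, Real.exp (a i / β)

/-- The Gibbs weights `exp (a i / β)`, normalized. -/
noncomputable def softmax {ι : Type*} [Fintype ι] (β : ℝ) (a : ι → ℝ) (i : ι) : ℝ :=
  Real.exp (a i / β) / sumExp β a

section Gibbs

variable {ι : Type*} [Fintype ι] (β : ℝ) (a : ι → ℝ)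

theorem sumExp_nonneg : 0 ≤ sumExp β a := Finset.sum_nonneg fun _ _ => (Real.exp_pos _).le

theorem sumExp_pos [Nonempty ι] : 0 < sumExp β a :=
  Finset.sum_pos (fun _ _ => Real.exp_pos _) Finset.univ_nonempty

theorem exp_le_sumExp (i : ι) : Real.exp (a i / β) ≤ sumExp β a :=
  Finset.single_le_sum (f := fun i => Real.exp (a i / β)) (fun _ _ => (Real.exp_pos _).le)
    (Finset.mem_univ i)

theorem softmax_nonneg (i : ι) : 0 ≤ softmax β a i :=
  div_nonneg (Real.exp_pos _).le (sumExp_nonneg β a)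

theorem softmax_mem_stdSimplex [Nonempty ι] : softmax β a ∈ stdSimplex ℝ ι :=
  ⟨softmax_nonneg β a, by
    simp only [softmax]
    rw [← Finset.sum_div]
    exact div_self (sumExp_pos β a).ne'⟩

/-- The ratio of the two partition functions is the moment generating function of `z` under the
softmax weights, so Hoeffding's lemma applies. -/
theorem sumExp_add_smul_le [Nonempty ι] {z : ι → ℝ} (hz : ∀ i, z i ∈ Set.Icc (0 : ℝ) 1) (t : ℝ) :
    sumExp β (a + t • z) ≤ sumExp β a *
      Real.exp (t / β * ∑ i, softmax β a i * z i + (t / β) ^ 2 / 8) := by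
  have e : sumExp β (a + t • z)
      = sumExp β a * ∑ i, softmax β a i * Real.exp (t / β * z i) := by
    rw [Finset.mul_sum]
    refine Finset.sum_congr rfl fun i _ => ?_
    have h := (sumExp_pos β a).ne'
    rw [softmax, Pi.add_apply, Pi.smul_apply, smul_eq_mul, add_div, Real.exp_add]
    field_simp
  rw [e]
  exact mul_le_mul_of_nonneg_left
    (sum_mul_exp_le_of_mem_Icc (softmax_mem_stdSimplex β a) hz _) (sumExp_nonneg β a)

end Gibbs

/-! ### The exponential potential and its drift -/

section Potential

variable {m n : ℕ} (M : Matrix (Fin m) (Fin n) ℝ)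

/-- The exponential potential of the vectors of multiplicities `p`, `q`. -/
noncomputable def sfpPotential (β θ : ℝ) (p : Fin m → ℝ) (q : Fin n → ℝ) : ℝ :=
  sumExp β (p ᵥ* M) ^ θ * sumExp β (-(M *ᵥ q)) ^ θ

theorem sfpPotential_nonneg (β θ : ℝ) (p : Fin m → ℝ) (q : Fin n → ℝ) :
    0 ≤ sfpPotential M β θ p q :=
  mul_nonneg (Real.rpow_nonneg (sumExp_nonneg _ _) _) (Real.rpow_nonneg (sumExp_nonneg _ _) _)

variable {M}

theorem sfpPotential_add_single_le [Nonempty (Fin m)] [Nonempty (Fin n)]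
    (hM : ∀ i j, M i j ∈ Set.Icc (0 : ℝ) 1) (β : ℝ) {θ : ℝ} (hθ : 0 ≤ θ)
    (p : Fin m → ℝ) (q : Fin n → ℝ) (i : Fin m) (j : Fin n) :
    sfpPotential M β θ (p + Pi.single i 1) (q + Pi.single j 1) ≤
      sfpPotential M β θ p q * Real.exp (θ / (4 * β ^ 2)) *
        Real.exp (θ / β * ∑ j', softmax β (p ᵥ* M) j' * M i j') *
        Real.exp (-(θ / β) * ∑ i', softmax β (-(M *ᵥ q)) i' * M i' j) := by
  have h1 := sumExp_add_smul_le β (p ᵥ* M) (z := fun j' => M i j') (fun j' => hM i j') 1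
  have h2 := sumExp_add_smul_le β (-(M *ᵥ q)) (z := fun i' => M i' j) (fun i' => hM i' j) (-1)
  have e1 : (p + Pi.single i 1) ᵥ* M = p ᵥ* M + (1 : ℝ) • fun j' => M i j' := by
    rw [Matrix.add_vecMul, Matrix.single_one_vecMul, one_smul]
    rfl
  have e2 : -(M *ᵥ (q + Pi.single j 1)) = -(M *ᵥ q) + (-1 : ℝ) • fun i' => M i' j := by
    rw [Matrix.mulVec_add, Matrix.mulVec_single_one]
    ext i'
    simp [Matrix.col]
    ring
  rw [← e1] at h1
  rw [← e2] at h2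
  have h3 := mul_le_mul (Real.rpow_le_rpow (sumExp_nonneg _ _) h1 hθ)
    (Real.rpow_le_rpow (sumExp_nonneg _ _) h2 hθ)
    (Real.rpow_nonneg (sumExp_nonneg _ _) _)
    (Real.rpow_nonneg (mul_nonneg (sumExp_nonneg _ _) (Real.exp_pos _).le) _)
  refine h3.trans_eq ?_
  rw [Real.mul_rpow (sumExp_nonneg _ _) (Real.exp_pos _).le,
    Real.mul_rpow (sumExp_nonneg _ _) (Real.exp_pos _).le, ← Real.exp_mul, ← Real.exp_mul,
    mul_mul_mul_comm, ← Real.exp_add]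
  change sfpPotential M β θ p q * _ = _
  simp only [mul_assoc, ← Real.exp_add]
  congr 2
  ring

/-- The drift estimate: averaging over independent softmax choices removes the first-order term, and
only the second-order Hoeffding errors survive. -/
theorem sum_sum_softmax_mul_sfpPotential_le [Nonempty (Fin m)] [Nonempty (Fin n)]
    (hM : ∀ i j, M i j ∈ Set.Icc (0 : ℝ) 1) (β : ℝ) {θ : ℝ} (hθ : 0 ≤ θ)
    (p : Fin m → ℝ) (q : Fin n → ℝ) :
    ∑ i, ∑ j, softmax β (-(M *ᵥ q)) i * softmax β (p ᵥ* M) j *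
        sfpPotential M β θ (p + Pi.single i 1) (q + Pi.single j 1) ≤
      Real.exp (θ / (4 * β ^ 2) + (θ / β) ^ 2 / 4) * sfpPotential M β θ p q := by
  set x := softmax β (-(M *ᵥ q)) with hx
  set y := softmax β (p ᵥ* M) with hy
  have hxs : x ∈ stdSimplex ℝ (Fin m) := softmax_mem_stdSimplex _ _
  have hys : y ∈ stdSimplex ℝ (Fin n) := softmax_mem_stdSimplex _ _
  have avg : ∀ {d : ℕ} {w z : Fin d → ℝ}, w ∈ stdSimplex ℝ (Fin d) →
      (∀ i, z i ∈ Set.Icc (0 : ℝ) 1) → ∑ i, w i * z i ∈ Set.Icc (0 : ℝ) 1 := by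
    intro d w z hw hz
    refine ⟨Finset.sum_nonneg fun i _ => mul_nonneg (hw.1 i) (hz i).1, ?_⟩
    rw [← hw.2]
    exact Finset.sum_le_sum fun i _ => mul_le_of_le_one_right (hw.1 i) (hz i).2
  have h1 := sum_mul_exp_le_of_mem_Icc hxs (z := fun i => ∑ j, y j * M i j)
    (fun i => avg hys fun j => hM i j) (θ / β)
  have h2 := sum_mul_exp_le_of_mem_Icc hys (z := fun j => ∑ i, x i * M i j)
    (fun j => avg hxs fun i => hM i j) (-(θ / β))
  -- Both means equal `xᵀMy`; they enter with opposite signs and cancel.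
  have e : ∑ i, x i * ∑ j, y j * M i j = ∑ j, y j * ∑ i, x i * M i j := by
    simp only [Finset.mul_sum]
    rw [Finset.sum_comm]
    exact Finset.sum_congr rfl fun j _ => Finset.sum_congr rfl fun i _ => by ring
  have h3 := mul_le_mul h1 h2 (Finset.sum_nonneg fun j _ =>
    mul_nonneg (hys.1 j) (Real.exp_pos _).le) (Real.exp_pos _).le
  rw [← Real.exp_add, e, Finset.sum_mul_sum] at h3
  set K := sfpPotential M β θ p q * Real.exp (θ / (4 * β ^ 2)) with hK
  have hK0 : 0 ≤ K := mul_nonneg (sfpPotential_nonneg _ _ _ _ _) (Real.exp_pos _).le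
  calc _ ≤ ∑ i, ∑ j, K * (x i * Real.exp (θ / β * ∑ j, y j * M i j) *
        (y j * Real.exp (-(θ / β) * ∑ i, x i * M i j))) := by
        refine Finset.sum_le_sum fun i _ => Finset.sum_le_sum fun j _ => ?_
        refine (mul_le_mul_of_nonneg_left (sfpPotential_add_single_le hM β hθ p q i j)
          (mul_nonneg (hxs.1 i) (hys.1 j))).trans_eq ?_
        rw [← hx, ← hy, ← hK]
        ring
    _ = K * _ := by simp only [← Finset.mul_sum]
    _ ≤ K * _ := mul_le_mul_of_nonneg_left h3 hK0
    _ = _ := by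
        rw [hK, mul_assoc, ← Real.exp_add, mul_comm]
        congr 2
        ring

theorem sfpPotential_single_le (hM : ∀ i j, M i j ∈ Set.Icc (0 : ℝ) 1) {β θ : ℝ}
    (hβ : 0 < β) (hθ : 0 ≤ θ) (hmn : m ≤ n) (k : Fin m) (l : Fin n) :
    sfpPotential M β θ (Pi.single k 1) (Pi.single l 1) ≤
      Real.exp (θ * (2 * Real.log n + 1 / β)) := by
  have hn : (0 : ℝ) < n := Nat.cast_pos.2 l.pos
  have hm : (0 : ℝ) < m := Nat.cast_pos.2 k.pos
  have h1 : sumExp β (Pi.single k 1 ᵥ* M) ≤ Real.exp (Real.log n + 1 / β) := by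
    rw [Real.exp_add, Real.exp_log hn]
    refine (Finset.sum_le_card_nsmul _ _ (Real.exp (1 / β)) fun j _ => ?_).trans_eq (by simp)
    rw [Matrix.single_one_vecMul]
    exact Real.exp_le_exp.2 (div_le_div_of_nonneg_right (hM k j).2 hβ.le)
  have h2 : sumExp β (-(M *ᵥ Pi.single l 1)) ≤ Real.exp (Real.log n) := by
    rw [Real.exp_log hn]
    refine (Finset.sum_le_card_nsmul _ _ 1 fun i _ => ?_).trans ?_
    · rw [Matrix.mulVec_single_one]
      exact Real.exp_le_one_iff.2 (div_nonpos_of_nonpos_of_nonneg (neg_nonpos.2 (hM i l).1) hβ.le)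
    · simpa using hmn
  refine (mul_le_mul (Real.rpow_le_rpow (sumExp_nonneg _ _) h1 hθ)
    (Real.rpow_le_rpow (sumExp_nonneg _ _) h2 hθ) (Real.rpow_nonneg (sumExp_nonneg _ _) _)
    (Real.rpow_nonneg (Real.exp_pos _).le _)).trans_eq ?_
  rw [← Real.exp_mul, ← Real.exp_mul, ← Real.exp_add]
  congr 1
  ring

/-- Each partition function dominates its largest term, which belongs to a best response. -/
theorem exp_le_sfpPotential [Nonempty (Fin m)] [Nonempty (Fin n)] {β θ c : ℝ} (hβ : 0 < β)
    (hθ : 0 ≤ θ) (p : Fin m → ℝ) (q : Fin n → ℝ) (hc : c ≤ brValCol M p - brValRow M q) :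
    Real.exp (θ / β * c) ≤ sfpPotential M β θ p q := by
  obtain ⟨j, hj⟩ := exists_eq_ciSup_of_finite (f := fun j => (p ᵥ* M) j)
  obtain ⟨i, hi⟩ := exists_eq_ciInf_of_finite (f := fun i => (M *ᵥ q) i)
  have hc' : c ≤ (p ᵥ* M) j - (M *ᵥ q) i := by
    rw [brValCol, brValRow, ← hj, ← hi] at hc
    exact hc
  have h1 := Real.rpow_le_rpow (Real.exp_pos _).le (exp_le_sumExp β (p ᵥ* M) j) hθ
  have h2 := Real.rpow_le_rpow (Real.exp_pos _).le (exp_le_sumExp β (-(M *ᵥ q)) i) hθ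
  refine le_trans ?_ (mul_le_mul h1 h2 (Real.rpow_nonneg (Real.exp_pos _).le _)
    (Real.rpow_nonneg (sumExp_nonneg _ _) _))
  rw [← Real.exp_mul, ← Real.exp_mul, ← Real.exp_add, Real.exp_le_exp]
  calc θ / β * c ≤ θ / β * ((p ᵥ* M) j - (M *ᵥ q) i) :=
        mul_le_mul_of_nonneg_left hc' (div_nonneg hθ hβ.le)
    _ = _ := by simp only [Pi.neg_apply]; ring

end Potential

/-! ### The Gumbel trick -/

section Gumbel

/-- Multiplying the Gumbel density by a power of its distribution function only shifts its location
and scales its mass; this evaluates the integral in the Gumbel trick. -/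
theorem gumbelPDFReal_mul_exp_neg {β : ℝ} (hβ : 0 < β) {K : ℝ} (hK : 0 < K) (x : ℝ) :
    gumbelPDFReal 0 β x * Real.exp (-((K - 1) * Real.exp (-x / β)))
      = K⁻¹ * gumbelPDFReal (β * Real.log K) β x := by
  have h : Real.exp (-(x - β * Real.log K) / β) = K * Real.exp (-x / β) := by
    rw [show -(x - β * Real.log K) / β = Real.log K + -x / β by field_simp; ring,
      Real.exp_add, Real.exp_log hK]
  rw [gumbelPDFReal, gumbelPDFReal, h, sub_zero, mul_assoc, mul_assoc, ← Real.exp_add]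
  rw [show -Real.exp (-x / β) + -((K - 1) * Real.exp (-x / β)) = -(K * Real.exp (-x / β)) by ring]
  field_simp

/-- The **Gumbel trick**: adding independent Gumbel perturbations to the entries of `a`, the
index of a maximal entry has the softmax distribution. -/
theorem pi_gumbelMeasure_setOf_forall_le {β : ℝ} (hβ : 0 < β) {d : ℕ} (a : Fin d → ℝ)
    (j : Fin d) :
    (Measure.pi fun _ : Fin d => gumbelMeasure 0 β) {v | ∀ i, a i + v i ≤ a j + v j}
      = ENNReal.ofReal (softmax β a j) := by
  obtain _ | d := d
  · exact j.elim0
  have := isProbabilityMeasure_gumbelMeasure hβ 0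
  have hmp := measurePreserving_piFinSuccAbove (fun _ : Fin (d + 1) => gumbelMeasure 0 β) j
  -- Condition on the `j`-th perturbation: the others must then lie below explicit thresholds,
  -- independently.
  set A : Set (ℝ × (Fin d → ℝ)) := {z | ∀ k, z.2 k ≤ a j + z.1 - a (j.succAbove k)} with hA
  have hAm : MeasurableSet A := by
    rw [hA, ofPred_forall]
    exact MeasurableSet.iInter fun k => measurableSet_le (by fun_prop) (by fun_prop)
  have hpre : {v : Fin (d + 1) → ℝ | ∀ i, a i + v i ≤ a j + v j}
      = MeasurableEquiv.piFinSuccAbove (fun _ => ℝ) j ⁻¹' A := by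
    ext v
    simp only [mem_ofPred_eq, mem_preimage, hA, j.forall_iff_succAbove, le_refl, true_and]
    refine forall_congr' fun k => ?_
    rw [le_sub_iff_add_le, add_comm (a _)]
    rfl
  have hS : 0 < sumExp β a := sumExp_pos β a
  have hs : 0 < softmax β a j := div_pos (Real.exp_pos _) hS
  set K := (softmax β a j)⁻¹ with hK
  -- The product of the distribution functions at these thresholds has exponent `-(K - 1) exp
  -- (-x/β)`, where `K` is the inverse softmax weight.
  have hK1 : K - 1 = ∑ k, Real.exp ((a (j.succAbove k) - a j) / β) := by
    rw [hK, softmax, inv_div, sumExp, Fin.sum_univ_succAbove _ j, add_div,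
      div_self (Real.exp_pos _).ne', add_sub_cancel_left, Finset.sum_div]
    refine Finset.sum_congr rfl fun k _ => ?_
    rw [sub_div, Real.exp_sub]
  rw [hpre, hmp.measure_preimage hAm.nullMeasurableSet, Measure.prod_apply hAm]
  have hsec : ∀ x : ℝ, (Measure.pi fun _ : Fin d => gumbelMeasure 0 β) (Prod.mk x ⁻¹' A)
      = ENNReal.ofReal (Real.exp (-((K - 1) * Real.exp (-x / β)))) := fun x => by
    have : Prod.mk x ⁻¹' A = univ.pi fun k => Iic (a j + x - a (j.succAbove k)) := by
      ext w
      simp [hA, Pi.le_def]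
    rw [this, Measure.pi_pi]
    simp only [gumbelMeasure_Iic hβ]
    rw [← ENNReal.ofReal_prod_of_nonneg fun k _ => (Real.exp_pos _).le, ← Real.exp_sum,
      Finset.sum_neg_distrib, hK1, Finset.sum_mul]
    congr 3
    refine Finset.sum_congr rfl fun k _ => ?_
    rw [← Real.exp_add]
    congr 1
    ring
  have hc : ∀ μ : ℝ, Continuous (gumbelPDFReal μ β) := fun μ => by
    unfold gumbelPDFReal
    fun_prop
  simp only [hsec]
  rw [gumbelMeasure, lintegral_withDensity_eq_lintegral_mul _ (hc 0).measurable.ennreal_ofReal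
    (by fun_prop)]
  calc _ = ∫⁻ x, ENNReal.ofReal (softmax β a j) *
        ENNReal.ofReal (gumbelPDFReal (β * Real.log K) β x) := by
        refine lintegral_congr fun x => ?_
        rw [Pi.mul_apply, ← ENNReal.ofReal_mul (gumbelPDFReal_nonneg hβ _ _),
          ← ENNReal.ofReal_mul hs.le, gumbelPDFReal_mul_exp_neg hβ (inv_pos.2 hs), hK, inv_inv]
    _ = ENNReal.ofReal (softmax β a j) * gumbelMeasure (β * Real.log K) β univ := by
        rw [lintegral_const_mul _ (hc _).measurable.ennreal_ofReal, gumbelMeasure,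
          withDensity_apply _ MeasurableSet.univ, Measure.restrict_univ]
    _ = _ := by
        have := isProbabilityMeasure_gumbelMeasure hβ (β * Real.log K)
        rw [measure_univ, mul_one]

variable {β : ℝ} {d : ℕ}

/-- An inequality suffices: the event that `g` selects `j` lies in the event that `j` is maximal, so
ties need not be shown to be null. -/
theorem lintegral_argmax_add_gumbel_le (hβ : 0 < β) {g : (Fin d → ℝ) → Fin d}
    (hg : IsArgmaxRule g) (a : Fin d → ℝ) (F : Fin d → ℝ≥0∞) :
    ∫⁻ v, F (g (a + v)) ∂(Measure.pi fun _ : Fin d => gumbelMeasure 0 β)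
      ≤ ∑ j, ENNReal.ofReal (softmax β a j) * F j := by
  have hm : Measurable fun v : Fin d → ℝ => g (a + v) := hg.1.comp (measurable_const_add a)
  rw [← lintegral_map (measurable_of_finite F) hm, lintegral_fintype]
  refine Finset.sum_le_sum fun j _ => ?_
  rw [mul_comm]
  refine mul_le_mul_left ?_ _
  rw [Measure.map_apply hm (measurableSet_singleton j), ← pi_gumbelMeasure_setOf_forall_le hβ]
  refine measure_mono fun v hv i => ?_
  have h := hg.2 (a + v) i
  rw [show g (a + v) = j from hv] at h
  exact h

theorem lintegral_argmin_sub_gumbel_le (hβ : 0 < β) {f : (Fin d → ℝ) → Fin d}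
    (hf : IsArgminRule f) (b : Fin d → ℝ) (F : Fin d → ℝ≥0∞) :
    ∫⁻ u, F (f (b - u)) ∂(Measure.pi fun _ : Fin d => gumbelMeasure 0 β)
      ≤ ∑ i, ENNReal.ofReal (softmax β (-b) i) * F i := by
  have hg : IsArgmaxRule fun x => f (-x) :=
    ⟨hf.1.comp measurable_neg, fun x i => neg_le_neg_iff.1 (hf.2 (-x) i)⟩
  have h := lintegral_argmax_add_gumbel_le hβ hg (-b) F
  simpa only [neg_add, neg_neg, ← sub_eq_add_neg] using h

end Gumbel

/-! ### Independence of the perturbations -/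

section Perturbation

variable {Ω κ : Type*} {m n : ℕ} {β : ℝ}
  {u : κ → Ω → Fin m → ℝ} {v : κ → Ω → Fin n → ℝ}

/-- The σ-algebra generated by the components in `S` of the perturbation vectors. -/
@[reducible]
def perturbationSigma (u : κ → Ω → Fin m → ℝ) (v : κ → Ω → Fin n → ℝ)
    (S : Set (κ × (Fin m ⊕ Fin n))) : MeasurableSpace Ω :=
  ⨆ x ∈ S, MeasurableSpace.comap (fun ω => Sum.elim (u x.1 ω) (v x.1 ω) x.2) inferInstance

theorem measurable_row_perturbationSigma {S : Set (κ × (Fin m ⊕ Fin n))} {a : κ}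
    (h : ∀ i, (a, Sum.inl i) ∈ S) : Measurable[perturbationSigma u v S] (u a) := by
  refine @measurable_pi_lambda _ _ _ (perturbationSigma u v S) _ _ fun i => ?_
  rw [measurable_iff_comap_le]
  exact le_biSup (fun x : κ × (Fin m ⊕ Fin n) => MeasurableSpace.comap
    (fun ω => Sum.elim (u x.1 ω) (v x.1 ω) x.2) inferInstance) (h i)

theorem measurable_col_perturbationSigma {S : Set (κ × (Fin m ⊕ Fin n))} {a : κ}
    (h : ∀ j, (a, Sum.inr j) ∈ S) : Measurable[perturbationSigma u v S] (v a) := by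
  refine @measurable_pi_lambda _ _ _ (perturbationSigma u v S) _ _ fun j => ?_
  rw [measurable_iff_comap_le]
  exact le_biSup (fun x : κ × (Fin m ⊕ Fin n) => MeasurableSpace.comap
    (fun ω => Sum.elim (u x.1 ω) (v x.1 ω) x.2) inferInstance) (h j)

variable [MeasurableSpace Ω] {P : Measure Ω}

namespace IsGumbelPerturbation

theorem comp_injective (h : IsGumbelPerturbation β u v P) {κ' : Type*} {e : κ' → κ}
    (he : Function.Injective e) :
    IsGumbelPerturbation β (fun a => u (e a)) (fun a => v (e a)) P where
  law_row a := h.law_row (e a)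
  law_col a := h.law_col (e a)
  indep := h.indep.precomp (g := Prod.map e id) (he.prodMap Function.injective_id)

/-- Perturbations have modifications that are measurable, not just almost everywhere. -/
theorem exists_measurable_modification [Countable κ] (h : IsGumbelPerturbation β u v P) :
    ∃ (u' : κ → Ω → Fin m → ℝ) (v' : κ → Ω → Fin n → ℝ),
      (∀ a, Measurable (u' a)) ∧ (∀ a, Measurable (v' a)) ∧ IsGumbelPerturbation β u' v' P ∧
        ∀ᵐ ω ∂P, ∀ a, u a ω = u' a ω ∧ v a ω = v' a ω := by
  have hu := fun a i => (h.law_row a i).aemeasurable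
  have hv := fun a j => (h.law_col a j).aemeasurable
  refine ⟨fun a ω i => (hu a i).mk _ ω, fun a ω j => (hv a j).mk _ ω,
    fun a => measurable_pi_lambda _ fun i => (hu a i).measurable_mk,
    fun a => measurable_pi_lambda _ fun j => (hv a j).measurable_mk,
    ⟨fun a i => (h.law_row a i).congr (hu a i).ae_eq_mk.symm,
      fun a j => (h.law_col a j).congr (hv a j).ae_eq_mk.symm, h.indep.congr ?_⟩, ?_⟩
  · rintro ⟨a, i | j⟩
    · exact (hu a i).ae_eq_mk
    · exact (hv a j).ae_eq_mk
  · refine ae_all_iff.2 fun a => ?_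
    filter_upwards [ae_all_iff.2 fun i => (hu a i).ae_eq_mk,
      ae_all_iff.2 fun j => (hv a j).ae_eq_mk] with ω h1 h2
    exact ⟨funext h1, funext h2⟩

/-- Serves three times: to separate past from present, rows from columns, and different runs. -/
theorem indep_perturbationSigma (h : IsGumbelPerturbation β u v P)
    (hu : ∀ a, Measurable (u a)) (hv : ∀ a, Measurable (v a))
    {S T : Set (κ × (Fin m ⊕ Fin n))} (hST : Disjoint S T) :
    Indep (perturbationSigma u v S) (perturbationSigma u v T) P := by
  refine indep_iSup_of_disjoint ?_ h.indep hST
  rintro ⟨a, i | j⟩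
  · exact ((measurable_pi_apply i).comp (hu a)).comap_le
  · exact ((measurable_pi_apply j).comp (hv a)).comap_le

theorem indepFun_of_disjoint (h : IsGumbelPerturbation β u v P)
    (hu : ∀ a, Measurable (u a)) (hv : ∀ a, Measurable (v a))
    {S T : Set (κ × (Fin m ⊕ Fin n))} (hST : Disjoint S T)
    {A B : Type*} [MeasurableSpace A] [MeasurableSpace B] {X : Ω → A} {Y : Ω → B}
    (hX : Measurable[perturbationSigma u v S] X) (hY : Measurable[perturbationSigma u v T] Y) :
    IndepFun X Y P := by
  rw [IndepFun_iff_Indep]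
  exact indep_of_indep_of_le_left (indep_of_indep_of_le_right
    (h.indep_perturbationSigma hu hv hST) (measurable_iff_comap_le.1 hY))
    (measurable_iff_comap_le.1 hX)

variable [IsProbabilityMeasure P]

theorem map_row (h : IsGumbelPerturbation β u v P) (a : κ) :
    P.map (u a) = Measure.pi fun _ => gumbelMeasure 0 β := by
  have hi : iIndepFun (fun i ω => u a ω i) P :=
    h.indep.precomp (g := fun i : Fin m => (a, Sum.inl i)) fun i j hij => by simpa using hij
  have := (iIndepFun_iff_map_fun_eq_pi_map fun i => (h.law_row a i).aemeasurable).1 hi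
  simpa only [(h.law_row a _).map_eq] using this

theorem map_col (h : IsGumbelPerturbation β u v P) (a : κ) :
    P.map (v a) = Measure.pi fun _ => gumbelMeasure 0 β := by
  have hi : iIndepFun (fun j ω => v a ω j) P :=
    h.indep.precomp (g := fun j : Fin n => (a, Sum.inr j)) fun i j hij => by simpa using hij
  have := (iIndepFun_iff_map_fun_eq_pi_map fun i => (h.law_col a i).aemeasurable).1 hi
  simpa only [(h.law_col a _).map_eq] using this

end IsGumbelPerturbation

end Perturbation

/-! ### Measurability of the state -/

section State

variable {m n : ℕ} {M : Matrix (Fin m) (Fin n) ℝ} {f : (Fin m → ℝ) → Fin m}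
  {g : (Fin n → ℝ) → Fin n} {k : Fin m} {l : Fin n}

theorem sfpState_t (u : ℕ → Fin m → ℝ) (v : ℕ → Fin n → ℝ) (N : ℕ) :
    (sfpState M f g k l u v N).t = N + 1 := by
  induction N with
  | zero => rfl
  | succ N ih => rw [sfpState, sfpStep, ih]

theorem measurable_sfpStep (hf : IsArgminRule f) (hg : IsArgmaxRule g) :
    Measurable fun z : ((Fin m → ℝ) × (Fin n → ℝ)) × (Fin m → ℝ) × (Fin n → ℝ) =>
      (z.1.1 + Pi.single (f (M *ᵥ z.1.2 - z.2.1)) 1,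
        z.1.2 + Pi.single (g (z.1.1 ᵥ* M + z.2.2)) (1 : ℝ)) := by
  have hs : ∀ d, Measurable fun i : Fin d => (Pi.single i 1 : Fin d → ℝ) :=
    fun d => measurable_of_finite _
  have h1 : Measurable fun z : ((Fin m → ℝ) × (Fin n → ℝ)) × (Fin m → ℝ) × (Fin n → ℝ) =>
      M *ᵥ z.1.2 - z.2.1 := by
    refine Continuous.measurable ?_
    fun_prop
  have h2 : Measurable fun z : ((Fin m → ℝ) × (Fin n → ℝ)) × (Fin m → ℝ) × (Fin n → ℝ) =>
      z.1.1 ᵥ* M + z.2.2 := by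
    refine Continuous.measurable ?_
    fun_prop
  exact (measurable_fst.fst.add ((hs m).comp (hf.1.comp h1))).prodMk
    (measurable_fst.snd.add ((hs n).comp (hg.1.comp h2)))

/-- Only perturbations before `N` are assumed measurable, so the σ-algebra can be taken to be that
of the past; this shows that the state is independent of the next perturbation. -/
theorem measurable_sfpState {Ω : Type*} [MeasurableSpace Ω] (hf : IsArgminRule f)
    (hg : IsArgmaxRule g) {u : ℕ → Ω → Fin m → ℝ} {v : ℕ → Ω → Fin n → ℝ} {N : ℕ}
    (hu : ∀ t < N, Measurable (u t)) (hv : ∀ t < N, Measurable (v t)) :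
    Measurable fun ω => ((sfpState M f g k l (fun t => u t ω) (fun t => v t ω) N).p,
      (sfpState M f g k l (fun t => u t ω) (fun t => v t ω) N).q) := by
  induction N with
  | zero => exact measurable_const (a := ((Pi.single k 1 : Fin m → ℝ), (Pi.single l 1 : Fin n → ℝ)))
  | succ N ih =>
    exact (measurable_sfpStep hf hg).comp
      ((ih (fun t ht => hu t (ht.trans N.lt_succ_self))
        fun t ht => hv t (ht.trans N.lt_succ_self)).prodMk
      ((hu N N.lt_succ_self).prodMk (hv N N.lt_succ_self)))

theorem measurable_brValCol_sub_brValRow :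
    Measurable fun z : (Fin m → ℝ) × (Fin n → ℝ) => brValCol M z.1 - brValRow M z.2 := by
  refine Measurable.sub (Measurable.iSup fun j => ?_) (Measurable.iInf fun i => ?_)
  · exact (by fun_prop : Continuous fun z : (Fin m → ℝ) × (Fin n → ℝ) => (z.1 ᵥ* M) j).measurable
  · exact (by fun_prop : Continuous fun z : (Fin m → ℝ) × (Fin n → ℝ) => (M *ᵥ z.2) i).measurable

theorem continuous_sumExp {ι : Type*} [Fintype ι] (β : ℝ) :
    Continuous (sumExp β : (ι → ℝ) → ℝ) := by
  unfold sumExp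
  fun_prop

theorem measurable_sfpPotential (β θ : ℝ) :
    Measurable fun z : (Fin m → ℝ) × (Fin n → ℝ) => sfpPotential M β θ z.1 z.2 := by
  have h1 : Measurable fun z : (Fin m → ℝ) × (Fin n → ℝ) => sumExp β (z.1 ᵥ* M) :=
    ((continuous_sumExp β).comp (by fun_prop)).measurable
  have h2 : Measurable fun z : (Fin m → ℝ) × (Fin n → ℝ) => sumExp β (-(M *ᵥ z.2)) :=
    ((continuous_sumExp β).comp (by fun_prop)).measurable
  exact (h1.pow_const θ).mul (h2.pow_const θ)

theorem measurableSet_sfpDone {Ω : Type*} [MeasurableSpace Ω] (ε : ℝ) (hf : IsArgminRule f)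
    (hg : IsArgmaxRule g) {u : ℕ → Ω → Fin m → ℝ} {v : ℕ → Ω → Fin n → ℝ} {N : ℕ}
    (hu : ∀ t < N, Measurable (u t)) (hv : ∀ t < N, Measurable (v t)) :
    MeasurableSet {ω | sfpDone M ε (sfpState M f g k l (fun t => u t ω) (fun t => v t ω) N)} := by
  have h := (measurable_brValCol_sub_brValRow (M := M)).comp
    (measurable_sfpState (M := M) (k := k) (l := l) hf hg hu hv)
  simp only [sfpDone, sfpState_t]
  exact measurableSet_le h measurable_const

end State

/-! ### Expected potential and tail bound for one run -/

section OneRun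

variable {Ω : Type*} [MeasurableSpace Ω] {P : Measure Ω} [IsProbabilityMeasure P]
  {m n : ℕ} {M : Matrix (Fin m) (Fin n) ℝ} {f : (Fin m → ℝ) → Fin m}
  {g : (Fin n → ℝ) → Fin n} {k : Fin m} {l : Fin n}
  {u : ℕ → Ω → Fin m → ℝ} {v : ℕ → Ω → Fin n → ℝ} {β θ : ℝ}

theorem lintegral_perturbed_best_responses_le (hβ : 0 < β) (hf : IsArgminRule f)
    (hg : IsArgmaxRule g) (b : Fin m → ℝ) (a : Fin n → ℝ) (F : Fin m → Fin n → ℝ≥0∞) :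
    ∫⁻ w, F (f (b - w.1)) (g (a + w.2))
        ∂((Measure.pi fun _ : Fin m => gumbelMeasure 0 β).prod
          (Measure.pi fun _ : Fin n => gumbelMeasure 0 β))
      ≤ ∑ i, ENNReal.ofReal (softmax β (-b) i) *
        ∑ j, ENNReal.ofReal (softmax β a j) * F i j := by
  have := isProbabilityMeasure_gumbelMeasure hβ 0
  have h1 : Measurable fun w : (Fin m → ℝ) × (Fin n → ℝ) => f (b - w.1) :=
    hf.1.comp (measurable_fst.const_sub b)
  have h2 : Measurable fun w : (Fin m → ℝ) × (Fin n → ℝ) => g (a + w.2) :=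
    hg.1.comp (measurable_snd.const_add a)
  have h3 : Measurable fun w : (Fin m → ℝ) × (Fin n → ℝ) => F (f (b - w.1)) (g (a + w.2)) :=
    (measurable_of_finite (Function.uncurry F)).comp (h1.prodMk h2)
  rw [lintegral_prod _ h3.aemeasurable]
  exact (lintegral_mono fun w => lintegral_argmax_add_gumbel_le hβ hg a (F (f (b - w)))).trans
    (lintegral_argmin_sub_gumbel_le hβ hf b fun i =>
      ∑ j, ENNReal.ofReal (softmax β a j) * F i j)

theorem lintegral_sfpPotential_sfpStep_le (hM : ∀ i j, M i j ∈ Set.Icc (0 : ℝ) 1)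
    (hf : IsArgminRule f) (hg : IsArgmaxRule g) (k : Fin m) (l : Fin n)
    (hβ : 0 < β) (hθ : 0 ≤ θ) (p : Fin m → ℝ) (q : Fin n → ℝ) :
    ∫⁻ w, ENNReal.ofReal (sfpPotential M β θ (p + Pi.single (f (M *ᵥ q - w.1)) 1)
        (q + Pi.single (g (p ᵥ* M + w.2)) 1))
        ∂((Measure.pi fun _ : Fin m => gumbelMeasure 0 β).prod
          (Measure.pi fun _ : Fin n => gumbelMeasure 0 β))
      ≤ ENNReal.ofReal (Real.exp (θ / (4 * β ^ 2) + (θ / β) ^ 2 / 4)) *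
        ENNReal.ofReal (sfpPotential M β θ p q) := by
  have : Nonempty (Fin m) := ⟨k⟩
  have : Nonempty (Fin n) := ⟨l⟩
  have h := lintegral_perturbed_best_responses_le hβ hf hg (M *ᵥ q) (p ᵥ* M) fun i j =>
    ENNReal.ofReal (sfpPotential M β θ (p + Pi.single i 1) (q + Pi.single j 1))
  refine h.trans ?_
  rw [← ENNReal.ofReal_mul (Real.exp_pos _).le]
  refine le_trans (le_of_eq ?_)
    (ENNReal.ofReal_le_ofReal (sum_sum_softmax_mul_sfpPotential_le hM β hθ p q))
  have h0 : ∀ i j, 0 ≤ softmax β (-(M *ᵥ q)) i * softmax β (p ᵥ* M) j *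
      sfpPotential M β θ (p + Pi.single i 1) (q + Pi.single j 1) := fun i j =>
    mul_nonneg (mul_nonneg (softmax_nonneg _ _ _) (softmax_nonneg _ _ _))
      (sfpPotential_nonneg _ _ _ _ _)
  rw [ENNReal.ofReal_sum_of_nonneg fun i _ => Finset.sum_nonneg fun j _ => h0 i j]
  refine Finset.sum_congr rfl fun i _ => ?_
  rw [ENNReal.ofReal_sum_of_nonneg fun j _ => h0 i j, Finset.mul_sum]
  refine Finset.sum_congr rfl fun j _ => ?_
  rw [mul_assoc, ENNReal.ofReal_mul (softmax_nonneg _ _ _),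
    ENNReal.ofReal_mul (softmax_nonneg _ _ _)]

/-- The state is independent of the fresh pair of perturbations, whose law is a product; by Fubini
the state can be frozen and the drift estimate applied. -/
theorem lintegral_sfpPotential_succ_le (hM : ∀ i j, M i j ∈ Set.Icc (0 : ℝ) 1)
    (hf : IsArgminRule f) (hg : IsArgmaxRule g) (k : Fin m) (l : Fin n)
    (hβ : 0 < β) (hθ : 0 ≤ θ) (h : IsGumbelPerturbation β u v P)
    (hu : ∀ t, Measurable (u t)) (hv : ∀ t, Measurable (v t)) (N : ℕ) :
    ∫⁻ ω, ENNReal.ofReal (sfpPotential M β θ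
        (sfpState M f g k l (fun t => u t ω) (fun t => v t ω) (N + 1)).p
        (sfpState M f g k l (fun t => u t ω) (fun t => v t ω) (N + 1)).q) ∂P
      ≤ ENNReal.ofReal (Real.exp (θ / (4 * β ^ 2) + (θ / β) ^ 2 / 4)) *
        ∫⁻ ω, ENNReal.ofReal (sfpPotential M β θ
          (sfpState M f g k l (fun t => u t ω) (fun t => v t ω) N).p
          (sfpState M f g k l (fun t => u t ω) (fun t => v t ω) N).q) ∂P := by
  have := isProbabilityMeasure_gumbelMeasure hβ 0
  set X : Ω → (Fin m → ℝ) × (Fin n → ℝ) := fun ω =>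
    ((sfpState M f g k l (fun t => u t ω) (fun t => v t ω) N).p,
      (sfpState M f g k l (fun t => u t ω) (fun t => v t ω) N).q) with hX
  have hXm : Measurable X := measurable_sfpState hf hg (fun t _ => hu t) fun t _ => hv t
  have hXw : IndepFun X (fun ω => (u N ω, v N ω)) P := by
    refine h.indepFun_of_disjoint hu hv (S := {x | x.1 < N}) (T := {x | x.1 = N}) ?_ ?_ ?_
    · exact disjoint_left.2 fun x hx hx' => hx.ne hx'
    · exact @measurable_sfpState m n M f g k l Ω (perturbationSigma u v _) hf hg u v N
        (fun t ht => measurable_row_perturbationSigma fun _ => ht)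
        (fun t ht => measurable_col_perturbationSigma fun _ => ht)
    · exact (measurable_row_perturbationSigma fun _ => rfl).prodMk
        (measurable_col_perturbationSigma fun _ => rfl)
  have huv : IndepFun (u N) (v N) P := by
    refine h.indepFun_of_disjoint hu hv (S := {x | x.2.isLeft}) (T := {x | x.2.isRight}) ?_
      (measurable_row_perturbationSigma fun _ => rfl)
      (measurable_col_perturbationSigma fun _ => rfl)
    rw [disjoint_left]
    rintro ⟨a, i | j⟩ h1 h2
    · exact Bool.false_ne_true h2
    · exact Bool.false_ne_true h1
  have hlaw : P.map (fun ω => (X ω, (u N ω, v N ω))) = (P.map X).prod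
      ((Measure.pi fun _ : Fin m => gumbelMeasure 0 β).prod
          (Measure.pi fun _ : Fin n => gumbelMeasure 0 β)) := by
    rw [(indepFun_iff_map_prod_eq_prod_map_map hXm.aemeasurable
      ((hu N).prodMk (hv N)).aemeasurable).1 hXw,
      (indepFun_iff_map_prod_eq_prod_map_map (hu N).aemeasurable (hv N).aemeasurable).1 huv,
      h.map_row, h.map_col]
  have hpot := measurable_sfpPotential (M := M) β θ
  set G : ((Fin m → ℝ) × (Fin n → ℝ)) × (Fin m → ℝ) × (Fin n → ℝ) → ℝ≥0∞ := fun z =>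
    ENNReal.ofReal (sfpPotential M β θ (z.1.1 + Pi.single (f (M *ᵥ z.1.2 - z.2.1)) 1)
      (z.1.2 + Pi.single (g (z.1.1 ᵥ* M + z.2.2)) 1)) with hG
  have hGm : Measurable G := (hpot.comp (measurable_sfpStep (M := M) hf hg)).ennreal_ofReal
  calc _ = ∫⁻ ω, G (X ω, (u N ω, v N ω)) ∂P := rfl
    _ = ∫⁻ z, G z ∂(P.map fun ω => (X ω, (u N ω, v N ω))) :=
        (lintegral_map hGm (hXm.prodMk ((hu N).prodMk (hv N)))).symm
    _ = ∫⁻ s, ∫⁻ w, G (s, w) ∂_ ∂(P.map X) := by rw [hlaw, lintegral_prod _ hGm.aemeasurable]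
    _ ≤ ∫⁻ s, ENNReal.ofReal (Real.exp (θ / (4 * β ^ 2) + (θ / β) ^ 2 / 4)) *
          ENNReal.ofReal (sfpPotential M β θ s.1 s.2) ∂(P.map X) :=
        lintegral_mono fun s => lintegral_sfpPotential_sfpStep_le hM hf hg k l hβ hθ s.1 s.2
    _ = _ := by
        rw [lintegral_const_mul _ hpot.ennreal_ofReal, lintegral_map hpot.ennreal_ofReal hXm]

theorem lintegral_sfpPotential_le (hM : ∀ i j, M i j ∈ Set.Icc (0 : ℝ) 1)
    (hf : IsArgminRule f) (hg : IsArgmaxRule g) (hmn : m ≤ n) (k : Fin m) (l : Fin n)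
    (hβ : 0 < β) (hθ : 0 ≤ θ) (h : IsGumbelPerturbation β u v P)
    (hu : ∀ t, Measurable (u t)) (hv : ∀ t, Measurable (v t)) (N : ℕ) :
    ∫⁻ ω, ENNReal.ofReal (sfpPotential M β θ
        (sfpState M f g k l (fun t => u t ω) (fun t => v t ω) N).p
        (sfpState M f g k l (fun t => u t ω) (fun t => v t ω) N).q) ∂P
      ≤ ENNReal.ofReal (Real.exp (N * (θ / (4 * β ^ 2) + (θ / β) ^ 2 / 4) +
        θ * (2 * Real.log n + 1 / β))) := by
  induction N with
  | zero =>
    simp only [sfpState, sfpInit, lintegral_const, measure_univ, mul_one, Nat.cast_zero,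
      zero_mul, zero_add]
    exact ENNReal.ofReal_le_ofReal (sfpPotential_single_le hM hβ hθ hmn k l)
  | succ N ih =>
    refine (lintegral_sfpPotential_succ_le hM hf hg k l hβ hθ h hu hv N).trans
      ((mul_le_mul_right ih _).trans_eq ?_)
    rw [← ENNReal.ofReal_mul (Real.exp_pos _).le, ← Real.exp_add]
    push_cast
    congr 2
    ring

/-- Exponential tail bound for the event that the guard of the loop holds after `N` iterations. -/
theorem measure_not_sfpDone_le (hM : ∀ i j, M i j ∈ Set.Icc (0 : ℝ) 1)
    (hf : IsArgminRule f) (hg : IsArgmaxRule g) (hmn : m ≤ n) (k : Fin m) (l : Fin n)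
    (hβ : 0 < β) (hθ : 0 ≤ θ) (h : IsGumbelPerturbation β u v P)
    (hu : ∀ t, Measurable (u t)) (hv : ∀ t, Measurable (v t)) (ε : ℝ) (N : ℕ) :
    P {ω | ¬ sfpDone M ε (sfpState M f g k l (fun t => u t ω) (fun t => v t ω) N)}
      ≤ ENNReal.ofReal (Real.exp (N * (θ / (4 * β ^ 2) + (θ / β) ^ 2 / 4) +
        θ * (2 * Real.log n + 1 / β) - θ / β * ((N + 1) * ε))) := by
  have : Nonempty (Fin m) := ⟨k⟩
  have : Nonempty (Fin n) := ⟨l⟩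
  have hc : ENNReal.ofReal (Real.exp (θ / β * ((N + 1) * ε))) ≠ 0 := by
    simpa using Real.exp_pos _
  rw [Real.exp_sub, ENNReal.ofReal_div_of_pos (Real.exp_pos _),
    ENNReal.le_div_iff_mul_le (Or.inl hc) (Or.inl ENNReal.ofReal_ne_top), mul_comm]
  -- Markov's inequality for the potential.
  refine le_trans (le_trans (mul_le_mul_right (measure_mono fun ω hω => ?_) _)
    (mul_meas_ge_le_lintegral ((measurable_sfpPotential (M := M) β θ).comp
      (measurable_sfpState hf hg (fun t _ => hu t) fun t _ => hv t)).ennreal_ofReal _))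
    (lintegral_sfpPotential_le hM hf hg hmn k l hβ hθ h hu hv N)
  refine ENNReal.ofReal_le_ofReal (exp_le_sfpPotential hβ hθ _ _ ?_)
  have h1 := not_le.1 hω
  rw [sfpState_t] at h1
  push_cast at h1
  exact h1.le

end OneRun

/-! ### Pathwise facts: equilibria and iteration counts -/

section Deterministic

variable {m n : ℕ} {M : Matrix (Fin m) (Fin n) ℝ} {f : (Fin m → ℝ) → Fin m}
  {g : (Fin n → ℝ) → Fin n} {k : Fin m} {l : Fin n}

theorem sfpState_p_nonneg (u : ℕ → Fin m → ℝ) (v : ℕ → Fin n → ℝ) (N : ℕ) :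
    0 ≤ (sfpState M f g k l u v N).p := by
  induction N with
  | zero => exact Pi.single_nonneg.2 zero_le_one
  | succ N ih => exact add_nonneg ih (Pi.single_nonneg.2 zero_le_one)

theorem sfpState_q_nonneg (u : ℕ → Fin m → ℝ) (v : ℕ → Fin n → ℝ) (N : ℕ) :
    0 ≤ (sfpState M f g k l u v N).q := by
  induction N with
  | zero => exact Pi.single_nonneg.2 zero_le_one
  | succ N ih => exact add_nonneg ih (Pi.single_nonneg.2 zero_le_one)

theorem sum_sfpState_p (u : ℕ → Fin m → ℝ) (v : ℕ → Fin n → ℝ) (N : ℕ) :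
    ∑ i, (sfpState M f g k l u v N).p i = N + 1 := by
  induction N with
  | zero => simp [sfpState, sfpInit]
  | succ N ih => simp [sfpState, sfpStep, Finset.sum_add_distrib, ih]

theorem sum_sfpState_q (u : ℕ → Fin m → ℝ) (v : ℕ → Fin n → ℝ) (N : ℕ) :
    ∑ j, (sfpState M f g k l u v N).q j = N + 1 := by
  induction N with
  | zero => simp [sfpState, sfpInit]
  | succ N ih => simp [sfpState, sfpStep, Finset.sum_add_distrib, ih]

theorem sfpRow_mem_stdSimplex (u : ℕ → Fin m → ℝ) (v : ℕ → Fin n → ℝ) (N : ℕ) :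
    sfpRow M f g k l u v N ∈ stdSimplex ℝ (Fin m) := by
  have h : (0 : ℝ) < N + 1 := by positivity
  refine ⟨fun i => mul_nonneg (by positivity) (sfpState_p_nonneg u v N i), ?_⟩
  simp only [sfpRow, Pi.smul_apply, smul_eq_mul]
  rw [← Finset.mul_sum, sum_sfpState_p, sfpState_t, Nat.cast_add_one, inv_mul_cancel₀ h.ne']

theorem sfpCol_mem_stdSimplex (u : ℕ → Fin m → ℝ) (v : ℕ → Fin n → ℝ) (N : ℕ) :
    sfpCol M f g k l u v N ∈ stdSimplex ℝ (Fin n) := by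
  have h : (0 : ℝ) < N + 1 := by positivity
  refine ⟨fun i => mul_nonneg (by positivity) (sfpState_q_nonneg u v N i), ?_⟩
  simp only [sfpCol, Pi.smul_apply, smul_eq_mul]
  rw [← Finset.mul_sum, sum_sfpState_q, sfpState_t, Nat.cast_add_one, inv_mul_cancel₀ h.ne']

theorem dotProduct_mulVec_le_brValCol (M : Matrix (Fin m) (Fin n) ℝ) (p : Fin m → ℝ)
    {q : Fin n → ℝ} (hq : q ∈ stdSimplex ℝ (Fin n)) : p ⬝ᵥ (M *ᵥ q) ≤ brValCol M p := by
  rw [Matrix.dotProduct_mulVec]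
  calc (p ᵥ* M) ⬝ᵥ q ≤ ∑ j, brValCol M p * q j := Finset.sum_le_sum fun j _ =>
        mul_le_mul_of_nonneg_right (le_ciSup (f := fun j => (p ᵥ* M) j)
          (finite_range _).bddAbove j) (hq.1 j)
    _ = brValCol M p := by rw [← Finset.mul_sum, hq.2, mul_one]

theorem brValRow_le_dotProduct_mulVec (M : Matrix (Fin m) (Fin n) ℝ) {p : Fin m → ℝ}
    (hp : p ∈ stdSimplex ℝ (Fin m)) (q : Fin n → ℝ) : brValRow M q ≤ p ⬝ᵥ (M *ᵥ q) := by
  calc brValRow M q = ∑ i, p i * brValRow M q := by rw [← Finset.sum_mul, hp.2, one_mul]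
    _ ≤ p ⬝ᵥ (M *ᵥ q) := Finset.sum_le_sum fun i _ =>
        mul_le_mul_of_nonneg_left (ciInf_le (f := fun i => (M *ᵥ q) i)
          (finite_range _).bddBelow i) (hp.1 i)

theorem brValCol_smul (M : Matrix (Fin m) (Fin n) ℝ) {c : ℝ} (hc : 0 ≤ c) (p : Fin m → ℝ) :
    brValCol M (c • p) = c * brValCol M p := by
  rw [brValCol, brValCol, Real.mul_iSup_of_nonneg hc]
  simp [Matrix.smul_vecMul]

theorem brValRow_smul (M : Matrix (Fin m) (Fin n) ℝ) {c : ℝ} (hc : 0 ≤ c) (q : Fin n → ℝ) :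
    brValRow M (c • q) = c * brValRow M q := by
  rw [brValRow, brValRow, Real.mul_iInf_of_nonneg hc]
  simp [Matrix.mulVec_smul]

/-- The payoff `p ⬝ᵥ (M *ᵥ q)` lies between the two best-response values, so each regret is at most
the gap. -/
theorem isEpsNash_of_sfpDone {ε : ℝ} {u : ℕ → Fin m → ℝ} {v : ℕ → Fin n → ℝ} {N : ℕ}
    (h : sfpDone M ε (sfpState M f g k l u v N)) :
    IsEpsNash M ε (sfpRow M f g k l u v N) (sfpCol M f g k l u v N) := by
  have hp := sfpRow_mem_stdSimplex (M := M) (f := f) (g := g) (k := k) (l := l) u v N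
  have hq := sfpCol_mem_stdSimplex (M := M) (f := f) (g := g) (k := k) (l := l) u v N
  have ht : (0 : ℝ) < (sfpState M f g k l u v N).t := by
    rw [sfpState_t]
    positivity
  have hgap : brValCol M (sfpRow M f g k l u v N) - brValRow M (sfpCol M f g k l u v N) ≤ ε := by
    rw [sfpRow, sfpCol, brValCol_smul M (inv_pos.2 ht).le, brValRow_smul M (inv_pos.2 ht).le,
      ← mul_sub, inv_mul_le_iff₀ ht]
    exact h
  have h1 := dotProduct_mulVec_le_brValCol M (sfpRow M f g k l u v N) hq
  have h2 := brValRow_le_dotProduct_mulVec M hp (sfpCol M f g k l u v N)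
  exact ⟨hp, hq, by linarith, by linarith⟩

/-- Disposes of `ε ≥ 1`, where `log n / ε²` may be too small to absorb additive constants. -/
theorem sfpDone_zero_of_one_le (hM : ∀ i j, M i j ∈ Set.Icc (0 : ℝ) 1) {ε : ℝ} (hε : 1 ≤ ε)
    (u : ℕ → Fin m → ℝ) (v : ℕ → Fin n → ℝ) : sfpDone M ε (sfpState M f g k l u v 0) := by
  have : Nonempty (Fin m) := ⟨k⟩
  have : Nonempty (Fin n) := ⟨l⟩
  have h1 : brValCol M (Pi.single k 1) ≤ 1 := ciSup_le fun j => by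
    rw [Matrix.single_one_vecMul]
    exact (hM k j).2
  have h2 : 0 ≤ brValRow M (Pi.single l 1) := le_ciInf fun i => by
    rw [Matrix.mulVec_single_one]
    exact (hM i l).1
  simp only [sfpDone, sfpState, sfpInit, Nat.cast_one, one_mul]
  linarith

theorem sfpIterations_le {ε : ℝ} {u : ℕ → Fin m → ℝ} {v : ℕ → Fin n → ℝ} {N : ℕ}
    (h : sfpDone M ε (sfpState M f g k l u v N)) : sfpIterations M ε f g k l u v ≤ N :=
  iInf₂_le N h

theorem exists_sfpIterations_eq {ε : ℝ} {u : ℕ → Fin m → ℝ} {v : ℕ → Fin n → ℝ} {T : ℕ}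
    (h : sfpDone M ε (sfpState M f g k l u v T)) :
    ∃ N ≤ T, sfpIterations M ε f g k l u v = N ∧ sfpDone M ε (sfpState M f g k l u v N) ∧
      ∀ t < N, ¬ sfpDone M ε (sfpState M f g k l u v t) := by
  classical
  have hex : ∃ N, sfpDone M ε (sfpState M f g k l u v N) := ⟨T, h⟩
  refine ⟨Nat.find hex, Nat.find_min' hex h, le_antisymm (sfpIterations_le (Nat.find_spec hex))
    (le_iInf₂ fun N hN => ?_), Nat.find_spec hex, fun t ht => Nat.find_min hex ht⟩
  exact_mod_cast Nat.find_min' hex hN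

/-- The guard holds at every time before termination. Only `≤` is available, because the unstopped
process may satisfy the guard again later. -/
theorem sfpIterations_le_tsum (ε : ℝ) (u : ℕ → Fin m → ℝ) (v : ℕ → Fin n → ℝ) :
    (sfpIterations M ε f g k l u v : ℝ≥0∞) ≤
      ∑' N, {N | ¬ sfpDone M ε (sfpState M f g k l u v N)}.indicator 1 N := by
  by_cases h : ∃ T, sfpDone M ε (sfpState M f g k l u v T)
  · obtain ⟨T, hT⟩ := h
    obtain ⟨N, -, hN, -, hlt⟩ := exists_sfpIterations_eq hT
    rw [hN]
    refine le_trans (le_of_eq ?_) (ENNReal.sum_le_tsum (Finset.range N))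
    rw [Finset.sum_congr rfl fun t ht =>
      indicator_of_mem (s := {N | ¬ sfpDone M ε (sfpState M f g k l u v N)})
        (hlt t (Finset.mem_range.1 ht)) 1]
    simp
  · have : {N | ¬ sfpDone M ε (sfpState M f g k l u v N)} = univ :=
      eq_univ_of_forall fun N hN => h ⟨N, hN⟩
    rw [this, indicator_univ]
    simp

theorem restartedIterations_le_tsum (T : ℕ) (τ : ℕ → ℕ∞) {s : Set ℕ}
    (hs : ∀ r, (T : ℕ∞) < τ r → r ∈ s) :
    restartedIterations T τ ≤ T * ∑' r, {r | ∀ r' < r, r' ∈ s}.indicator 1 r := by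
  rw [← ENNReal.tsum_mul_left, restartedIterations]
  refine ENNReal.tsum_le_tsum fun r => ?_
  split_ifs with h
  · rw [indicator_of_mem (show r ∈ {r | ∀ r' < r, r' ∈ s} from fun r' hr' => hs r' (h r' hr'))]
    simp
  · exact zero_le

theorem restartedIterations_eq_zero (T : ℕ) {τ : ℕ → ℕ∞} (h : ∀ r, τ r = 0) :
    restartedIterations T τ = 0 := by
  rw [restartedIterations, ENNReal.tsum_eq_zero]
  intro r
  split_ifs
  · simp [h]
  · rfl

end Deterministic

/-! ### Numerical estimates -/

section Parameters

/-- The logarithm of the tail bound with the parameters of the algorithm. -/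
theorem sfp_exponent_le {L ε R : ℝ} (hL : 0 < L) (hε : 0 < ε) (hR : R = (2 + √(2 * L)) / ε)
    {β θ : ℝ} (hβ : β = (2 + √(2 * L)) / (ε * √(8 * L))) (hθ : θ = 2 / √(2 * L)) {N : ℝ}
    (hN : R ^ 2 ≤ N) :
    N * (θ / (4 * β ^ 2) + (θ / β) ^ 2 / 4) + θ * (2 * L + 1 / β) - θ / β * ((N + 1) * ε)
      ≤ N * (-2 / R ^ 2) := by
  have h8 : √(8 * L) = 2 * √(2 * L) := by
    rw [show 8 * L = 2 ^ 2 * (2 * L) by ring, Real.sqrt_mul (by norm_num),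
      Real.sqrt_sq (by norm_num)]
  have hs2 : √(2 * L) ^ 2 = 2 * L := Real.sq_sqrt (by positivity)
  have hs : 0 < √(2 * L) := Real.sqrt_pos.2 (by positivity)
  rw [h8] at hβ
  rw [← hs2]
  generalize √(2 * L) = s at *
  have hR0 : 0 < R := by rw [hR]; positivity
  have hβ' : β = R / (2 * s) := by rw [hβ, hR]; field_simp
  have hε' : ε = (2 + s) / R := by rw [hR]; field_simp
  rw [hβ', hθ, hε', ← sub_nonpos]
  -- In terms of `R` and `s = √(2L)`: `β = R/(2s)`, `θ/β = 4/R`, `ε = (2+s)/R`. Completing the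
  -- square in `R` makes every term of the numerator nonpositive.
  have e : N * (2 / s / (4 * (R / (2 * s)) ^ 2) + (2 / s / (R / (2 * s))) ^ 2 / 4) +
      2 / s * (s ^ 2 + 1 / (R / (2 * s))) - 2 / s / (R / (2 * s)) * ((N + 1) * ((2 + s) / R)) -
      N * (-2 / R ^ 2) = (2 * s * (R ^ 2 - N) + 2 * (R ^ 2 - N) - 2 * (R - 1) ^ 2 - 6 - 4 * s)
        / R ^ 2 := by
    field_simp
    ring
  rw [e]
  refine div_nonpos_of_nonpos_of_nonneg ?_ (sq_nonneg R)
  nlinarith [mul_nonneg hs.le (sub_nonneg.2 hN), sq_nonneg (R - 1)]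

theorem inv_one_sub_exp_neg_le {x : ℝ} (hx : 0 < x) : (1 - Real.exp (-x))⁻¹ ≤ 1 + 1 / x := by
  have h : Real.exp (-x) ≤ (1 + x)⁻¹ := by
    rw [Real.exp_neg]
    exact inv_anti₀ (by positivity) (by linarith [Real.add_one_le_exp x])
  have h2 : (1 + 1 / x)⁻¹ ≤ 1 - Real.exp (-x) := by
    have : (1 + 1 / x)⁻¹ = 1 - (1 + x)⁻¹ := by field_simp; ring
    linarith
  exact inv_le_of_inv_le₀ (by positivity) h2

theorem sq_sfpCutoff_bound {L ε : ℝ} (hL : 1 / 2 ≤ L) (hε : 0 < ε) (hε1 : ε ≤ 1) :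
    ((2 + √(2 * L)) / ε) ^ 2 ≤ 20 * (L / ε ^ 2) ∧ 1 ≤ 2 * (L / ε ^ 2) := by
  have hs2 : √(2 * L) ^ 2 = 2 * L := Real.sq_sqrt (by positivity)
  have h2 : ε ^ 2 ≤ 1 := pow_le_one₀ hε.le hε1
  constructor
  · rw [div_pow, ← mul_div_assoc]
    refine div_le_div_of_nonneg_right ?_ (sq_nonneg ε)
    -- With `s = √(2L)`, `(2+s)² ≤ 8 + 2s² = 8 + 4L ≤ 20L`, since `L ≥ 1/2`.
    nlinarith [sq_nonneg (√(2 * L) - 2)]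
  · rw [← mul_div_assoc, le_div_iff₀ (by positivity)]
    linarith

end Parameters

/-! ### Expected iterations, without and with restarts -/

section Tail

variable {Ω : Type*} [MeasurableSpace Ω] {P : Measure Ω} [IsProbabilityMeasure P]
  {m n : ℕ} {M : Matrix (Fin m) (Fin n) ℝ} {f : (Fin m → ℝ) → Fin m}
  {g : (Fin n → ℝ) → Fin n} {ε : ℝ}

theorem log_natCast_ge_half (hn : 2 ≤ n) : 1 / 2 ≤ Real.log n := by
  have h1 : Real.log 2 ≤ Real.log n := Real.log_le_log (by norm_num) (by exact_mod_cast hn)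
  linarith [Real.log_two_gt_d9]

/-- The square of the scale on which the number of iterations concentrates. -/
noncomputable def sfpTime (n : ℕ) (ε : ℝ) : ℝ :=
  ((2 + √(2 * Real.log n)) / ε) ^ 2

theorem sfpTime_pos (n : ℕ) (hε : 0 < ε) : 0 < sfpTime n ε := by
  unfold sfpTime
  positivity

theorem sfpScale_pos (hn : 2 ≤ n) (hε : 0 < ε) : 0 < sfpScale n ε := by
  have hL := log_natCast_ge_half hn
  have : 0 < √(8 * Real.log n) := Real.sqrt_pos.2 (by linarith)
  unfold sfpScale
  positivity

theorem sfpTime_le_sfpCutoff (n : ℕ) (ε : ℝ) : sfpTime n ε ≤ sfpCutoff n ε := Nat.le_ceil _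

theorem sfpCutoff_le (n : ℕ) (hε : 0 < ε) : (sfpCutoff n ε : ℝ) ≤ sfpTime n ε + 1 :=
  (Nat.ceil_lt_add_one (sfpTime_pos n hε).le).le

variable (hM : ∀ i j, M i j ∈ Set.Icc (0 : ℝ) 1) (hf : IsArgminRule f) (hg : IsArgmaxRule g)
  (hmn : m ≤ n) (hn : 2 ≤ n) (hε : 0 < ε) (k : Fin m) (l : Fin n)
include hM hf hg hmn hn hε

theorem measure_not_sfpDone_le_pow {u : ℕ → Ω → Fin m → ℝ} {v : ℕ → Ω → Fin n → ℝ}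
    (h : IsGumbelPerturbation (sfpScale n ε) u v P)
    (hu : ∀ t, Measurable (u t)) (hv : ∀ t, Measurable (v t)) {N : ℕ} (hN : sfpCutoff n ε ≤ N) :
    P {ω | ¬ sfpDone M ε (sfpState M f g k l (fun t => u t ω) (fun t => v t ω) N)}
      ≤ ENNReal.ofReal (Real.exp (-(2 / sfpTime n ε))) ^ N := by
  have hL := log_natCast_ge_half hn
  refine (measure_not_sfpDone_le (θ := 2 / √(2 * Real.log n)) hM hf hg hmn k l
    (sfpScale_pos hn hε) (by positivity) h hu hv ε N).trans ?_
  rw [← ENNReal.ofReal_pow (Real.exp_pos _).le, ← Real.exp_nat_mul, ← neg_div]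
  refine ENNReal.ofReal_le_ofReal (Real.exp_le_exp.2 (sfp_exponent_le (by linarith) hε rfl rfl rfl
    ((sfpTime_le_sfpCutoff n ε).trans (Nat.cast_le.2 hN))))

theorem tsum_measure_not_sfpDone_le {u : ℕ → Ω → Fin m → ℝ} {v : ℕ → Ω → Fin n → ℝ}
    (h : IsGumbelPerturbation (sfpScale n ε) u v P)
    (hu : ∀ t, Measurable (u t)) (hv : ∀ t, Measurable (v t)) :
    ∑' N, P {ω | ¬ sfpDone M ε (sfpState M f g k l (fun t => u t ω) (fun t => v t ω) N)}
      ≤ ENNReal.ofReal (3 / 2 * sfpTime n ε + 2) := by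
  have hT := sfpTime_pos n hε
  set r := Real.exp (-(2 / sfpTime n ε)) with hr
  have hr1 : r < 1 := Real.exp_lt_one_iff.2 (neg_lt_zero.2 (by positivity))
  -- The trivial bound `1` before the cutoff, the geometric tail after it.
  calc _ ≤ ∑' N, ((Finset.range (sfpCutoff n ε) : Set ℕ).indicator 1 N + ENNReal.ofReal r ^ N) := by
        refine ENNReal.tsum_le_tsum fun N => ?_
        by_cases hN : N < sfpCutoff n ε
        · rw [indicator_of_mem (by simpa using hN)]
          exact prob_le_one.trans le_self_add
        · exact (measure_not_sfpDone_le_pow hM hf hg hmn hn hε k l h hu hv (not_lt.1 hN)).trans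
            le_add_self
    _ = ENNReal.ofReal (sfpCutoff n ε) + ENNReal.ofReal (1 - r)⁻¹ := by
        rw [ENNReal.tsum_add, ENNReal.tsum_geometric, ENNReal.ofReal_inv_of_pos (sub_pos.2 hr1),
          ENNReal.ofReal_sub 1 (hr ▸ (Real.exp_pos _).le), ENNReal.ofReal_one, ← sum_eq_tsum_indicator]
        simp
    _ ≤ _ := by
        rw [← ENNReal.ofReal_add (Nat.cast_nonneg _) (inv_nonneg.2 (sub_nonneg.2 hr1.le))]
        refine ENNReal.ofReal_le_ofReal ?_
        have h1 := inv_one_sub_exp_neg_le (x := 2 / sfpTime n ε) (by positivity)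
        have h2 := sfpCutoff_le n hε
        rw [one_div_div] at h1
        linarith

theorem ae_exists_sfpDone {u : ℕ → Ω → Fin m → ℝ} {v : ℕ → Ω → Fin n → ℝ}
    (h : IsGumbelPerturbation (sfpScale n ε) u v P)
    (hu : ∀ t, Measurable (u t)) (hv : ∀ t, Measurable (v t)) :
    ∀ᵐ ω ∂P, ∃ N, sfpDone M ε (sfpState M f g k l (fun t => u t ω) (fun t => v t ω) N) := by
  filter_upwards [ae_eventually_notMem ((tsum_measure_not_sfpDone_le hM hf hg hmn hn hε k l
    h hu hv).trans_lt ENNReal.ofReal_lt_top).ne] with ω hω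
  obtain ⟨N, hN⟩ := hω.exists
  exact ⟨N, not_not.1 hN⟩

theorem lintegral_sfpIterations_le {u : ℕ → Ω → Fin m → ℝ} {v : ℕ → Ω → Fin n → ℝ}
    (h : IsGumbelPerturbation (sfpScale n ε) u v P)
    (hu : ∀ t, Measurable (u t)) (hv : ∀ t, Measurable (v t)) :
    ∫⁻ ω, (sfpIterations M ε f g k l (fun t => u t ω) (fun t => v t ω) : ℝ≥0∞) ∂P
      ≤ ENNReal.ofReal (50 * (Real.log n / ε ^ 2)) := by
  rcases le_total 1 ε with h1 | h1
  · have h0 : ∀ ω, sfpIterations M ε f g k l (fun t => u t ω) (fun t => v t ω) = 0 := fun ω =>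
      nonpos_iff_eq_zero.1 (sfpIterations_le (sfpDone_zero_of_one_le hM h1 _ _))
    simp [h0]
  have hms : ∀ N, MeasurableSet {ω | ¬ sfpDone M ε
      (sfpState M f g k l (fun t => u t ω) (fun t => v t ω) N)} := fun N =>
    (measurableSet_sfpDone ε hf hg (fun t _ => hu t) fun t _ => hv t).compl
  have hsum := tsum_measure_not_sfpDone_le hM hf hg hmn hn hε k l h hu hv
  refine (lintegral_mono fun ω => sfpIterations_le_tsum ε _ _).trans ?_
  change ∫⁻ ω, ∑' N, {ω | ¬ sfpDone M ε (sfpState M f g k l (fun t => u t ω)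
    (fun t => v t ω) N)}.indicator (1 : Ω → ℝ≥0∞) ω ∂P ≤ _
  rw [lintegral_tsum fun N => (measurable_one.indicator (hms N)).aemeasurable]
  simp only [lintegral_indicator_one (hms _)]
  -- `3/2 * 20 + 2 * 2 = 34`, within the constant `50`; the variant with restarts needs `2 * (20 +
  -- 2) = 44`.
  refine hsum.trans (ENNReal.ofReal_le_ofReal ?_)
  obtain ⟨h2, h3⟩ := sq_sfpCutoff_bound (log_natCast_ge_half hn) hε h1
  rw [sfpTime]
  linarith

variable {u : ℕ × ℕ → Ω → Fin m → ℝ} {v : ℕ × ℕ → Ω → Fin n → ℝ}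
  (h : IsGumbelPerturbation (sfpScale n ε) u v P)
  (hu : ∀ a, Measurable (u a)) (hv : ∀ a, Measurable (v a))
include h hu hv

/-- Testing the guard only at the cutoff gives an event containing the one that the run is cut off.
These events depend on disjoint blocks of perturbations, so their probabilities multiply. -/
theorem measure_forall_not_sfpDone_le (r : ℕ) :
    P {ω | ∀ s < r, ¬ sfpDone M ε (sfpState M f g k l (fun t => u (s, t) ω)
      (fun t => v (s, t) ω) (sfpCutoff n ε))} ≤ 2⁻¹ ^ r := by
  set A : ℕ → Set Ω := fun s => {ω | ¬ sfpDone M ε (sfpState M f g k l (fun t => u (s, t) ω)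
    (fun t => v (s, t) ω) (sfpCutoff n ε))} with hA
  have hAm : ∀ (S : Set ((ℕ × ℕ) × (Fin m ⊕ Fin n))) (s : ℕ), (∀ t i, ((s, t), i) ∈ S) →
      MeasurableSet[perturbationSigma u v S] (A s) := fun S s hS =>
    @MeasurableSet.compl _ _ (perturbationSigma u v S)
      (@measurableSet_sfpDone m n M f g k l Ω (perturbationSigma u v S) ε hf hg
        (fun t => u (s, t)) (fun t => v (s, t)) (sfpCutoff n ε)
        (fun t _ => measurable_row_perturbationSigma fun i => hS t _)
        fun t _ => measurable_col_perturbationSigma fun i => hS t _)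
  -- The cutoff is at least `sfpTime n ε`, so the tail bound is at most `exp (-2) ≤ 1/2`.
  have hA2 : ∀ s, P (A s) ≤ 2⁻¹ := fun s => by
    have hinj : Function.Injective fun t : ℕ => (s, t) := fun a b hab => by simpa using hab
    refine (measure_not_sfpDone_le_pow hM hf hg hmn hn hε k l (h.comp_injective hinj)
      (fun t => hu _) (fun t => hv _) le_rfl).trans ?_
    rw [← ENNReal.ofReal_pow (Real.exp_pos _).le, ← Real.exp_nat_mul,
      show (2⁻¹ : ℝ≥0∞) = ENNReal.ofReal 2⁻¹ by
        rw [ENNReal.ofReal_inv_of_pos two_pos, ENNReal.ofReal_ofNat]]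
    refine ENNReal.ofReal_le_ofReal ?_
    rw [mul_neg, Real.exp_neg]
    refine inv_anti₀ two_pos ?_
    have hT := sfpTime_pos n hε
    have h1 : 2 ≤ sfpCutoff n ε * (2 / sfpTime n ε) := by
      rw [← mul_div_assoc, le_div_iff₀ hT]
      linarith [sfpTime_le_sfpCutoff n ε]
    linarith [Real.add_one_le_exp (sfpCutoff n ε * (2 / sfpTime n ε))]
  change P {ω | ∀ s < r, ω ∈ A s} ≤ _
  induction r with
  | zero => simp
  | succ r ih =>
    have e : {ω | ∀ s < r + 1, ω ∈ A s} = {ω | ∀ s < r, ω ∈ A s} ∩ A r := by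
      ext ω
      simp only [mem_ofPred_eq, mem_inter_iff, Nat.lt_succ_iff_lt_or_eq]
      exact ⟨fun H => ⟨fun s hs => H s (Or.inl hs), H r (Or.inr rfl)⟩, fun H s hs =>
        hs.elim (H.1 s) fun hs => hs ▸ H.2⟩
    have hind := h.indep_perturbationSigma hu hv (S := {x | x.1.1 < r}) (T := {x | x.1.1 = r})
      (disjoint_left.2 fun x hx hx' => hx.ne hx')
    have e2 : {ω | ∀ s < r, ω ∈ A s} = ⋂ s, ⋂ (_ : s < r), A s := by
      ext ω
      simp
    have hm1 : MeasurableSet[perturbationSigma u v {x | x.1.1 < r}] {ω | ∀ s < r, ω ∈ A s} := by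
      rw [e2]
      exact @MeasurableSet.iInter _ _ (perturbationSigma u v _) _ _ fun s =>
        @MeasurableSet.iInter _ _ (perturbationSigma u v _) _ _ fun hs => hAm _ s fun _ _ => hs
    rw [e, (Indep_iff _ _ _).1 hind _ _ hm1 (hAm _ r fun _ _ => rfl), pow_succ]
    exact mul_le_mul' ih (hA2 r)

theorem tsum_measure_forall_not_sfpDone_le :
    ∑' r, P {ω | ∀ s < r, ¬ sfpDone M ε (sfpState M f g k l (fun t => u (s, t) ω)
      (fun t => v (s, t) ω) (sfpCutoff n ε))} ≤ 2 := by
  refine (ENNReal.tsum_le_tsum fun r =>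
    measure_forall_not_sfpDone_le hM hf hg hmn hn hε k l h hu hv r).trans_eq ?_
  rw [ENNReal.tsum_geometric, ENNReal.one_sub_inv_two, inv_inv]

theorem ae_exists_run_sfpDone :
    ∀ᵐ ω ∂P, ∃ r, sfpDone M ε (sfpState M f g k l (fun t => u (r, t) ω)
      (fun t => v (r, t) ω) (sfpCutoff n ε)) := by
  filter_upwards [ae_eventually_notMem ((tsum_measure_forall_not_sfpDone_le hM hf hg hmn hn hε k l
    h hu hv).trans_lt ENNReal.ofNat_lt_top).ne] with ω hω
  obtain ⟨r, hr⟩ := hω.exists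
  by_contra hcon
  exact hr fun s _ hs => hcon ⟨s, hs⟩

theorem lintegral_restartedIterations_le :
    ∫⁻ ω, restartedIterations (sfpCutoff n ε) (fun r =>
        sfpIterations M ε f g k l (fun t => u (r, t) ω) (fun t => v (r, t) ω)) ∂P
      ≤ ENNReal.ofReal (50 * (Real.log n / ε ^ 2)) := by
  rcases le_total 1 ε with h1 | h1
  · have h0 : ∀ ω, restartedIterations (sfpCutoff n ε) (fun r =>
        sfpIterations M ε f g k l (fun t => u (r, t) ω) (fun t => v (r, t) ω)) = 0 := fun ω =>
      restartedIterations_eq_zero _ fun r =>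
        nonpos_iff_eq_zero.1 (sfpIterations_le (sfpDone_zero_of_one_le hM h1 _ _))
    simp [h0]
  have hms : ∀ r, MeasurableSet {ω | ∀ s < r, ¬ sfpDone M ε (sfpState M f g k l
      (fun t => u (s, t) ω) (fun t => v (s, t) ω) (sfpCutoff n ε))} := fun r => by
    simp only [ofPred_forall]
    exact MeasurableSet.iInter fun s => MeasurableSet.iInter fun _ =>
      (measurableSet_sfpDone ε hf hg (fun t _ => hu (s, t)) fun t _ => hv (s, t)).compl
  refine (lintegral_mono fun ω => restartedIterations_le_tsum (sfpCutoff n ε) _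
    (s := {r | ¬ sfpDone M ε (sfpState M f g k l (fun t => u (r, t) ω) (fun t => v (r, t) ω)
      (sfpCutoff n ε))}) fun r hr hd => (sfpIterations_le hd).not_gt hr).trans ?_
  change ∫⁻ ω, sfpCutoff n ε * ∑' r, {ω | ∀ s < r, ¬ sfpDone M ε (sfpState M f g k l
    (fun t => u (s, t) ω) (fun t => v (s, t) ω) (sfpCutoff n ε))}.indicator
      (1 : Ω → ℝ≥0∞) ω ∂P ≤ _
  rw [lintegral_const_mul' _ _ (ENNReal.natCast_ne_top _),
    lintegral_tsum fun r => (measurable_one.indicator (hms r)).aemeasurable]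
  simp only [lintegral_indicator_one (hms _)]
  refine (mul_le_mul_right (tsum_measure_forall_not_sfpDone_le hM hf hg hmn hn hε k l
    h hu hv) _).trans ?_
  rw [← ENNReal.ofReal_natCast, ← ENNReal.ofReal_ofNat 2, ← ENNReal.ofReal_mul (Nat.cast_nonneg _)]
  refine ENNReal.ofReal_le_ofReal ?_
  obtain ⟨h2, h3⟩ := sq_sfpCutoff_bound (log_natCast_ge_half hn) hε h1
  have h4 := sfpCutoff_le n hε
  rw [sfpTime] at h4
  linarith

end Tail
-- Assembly
theorem mainTheorem1 :
    ∃ C : ℝ, 0 < C ∧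
      ∀ (m n : ℕ) (_ : m ≤ n) (_ : 2 ≤ n)
        (M : Matrix (Fin m) (Fin n) ℝ) (_ : ∀ i j, M i j ∈ Set.Icc (0 : ℝ) 1)
        (ε : ℝ) (_ : 0 < ε)
        (f : (Fin m → ℝ) → Fin m) (_ : IsArgminRule f)
        (g : (Fin n → ℝ) → Fin n) (_ : IsArgmaxRule g)
        (k : Fin m) (l : Fin n)
        (Ω : Type*) (_ : MeasurableSpace Ω) (P : Measure Ω) (_ : IsProbabilityMeasure P),
        -- Stochastic Fictitious Play, run until it terminates
        (∀ (u : ℕ → Ω → Fin m → ℝ) (v : ℕ → Ω → Fin n → ℝ),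
          IsGumbelPerturbation (sfpScale n ε) u v P →
          (∀ᵐ ω ∂P, ∃ N : ℕ,
            sfpIterations M ε f g k l (fun t => u t ω) (fun t => v t ω) = N ∧
            IsEpsNash M ε (sfpRow M f g k l (fun t => u t ω) (fun t => v t ω) N)
              (sfpCol M f g k l (fun t => u t ω) (fun t => v t ω) N)) ∧
          ∫⁻ ω, (sfpIterations M ε f g k l (fun t => u t ω) (fun t => v t ω) : ℝ≥0∞) ∂P
            ≤ ENNReal.ofReal (C * (Real.log n / ε ^ 2))) ∧
        -- the variant with independent restarts after `sfpCutoff n ε` iterations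
        (∀ (u : ℕ × ℕ → Ω → Fin m → ℝ) (v : ℕ × ℕ → Ω → Fin n → ℝ),
          IsGumbelPerturbation (sfpScale n ε) u v P →
          (∀ᵐ ω ∂P, ∃ r N : ℕ,
            (∀ s < r, (sfpCutoff n ε : ℕ∞) <
              sfpIterations M ε f g k l (fun t => u (s, t) ω) (fun t => v (s, t) ω)) ∧
            N ≤ sfpCutoff n ε ∧
            sfpIterations M ε f g k l (fun t => u (r, t) ω) (fun t => v (r, t) ω) = N ∧
            IsEpsNash M ε (sfpRow M f g k l (fun t => u (r, t) ω) (fun t => v (r, t) ω) N)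
              (sfpCol M f g k l (fun t => u (r, t) ω) (fun t => v (r, t) ω) N)) ∧
          ∫⁻ ω, restartedIterations (sfpCutoff n ε) (fun r =>
              sfpIterations M ε f g k l (fun t => u (r, t) ω) (fun t => v (r, t) ω)) ∂P
            ≤ ENNReal.ofReal (C * (Real.log n / ε ^ 2))) := by

  refine ⟨50, by norm_num, fun m n hmn hn M hM ε hε f hf g hg k l Ω _ P _ =>
    ⟨fun u v h => ?_, fun u v h => ?_⟩⟩
  -- `HasLaw` gives only a.e. measurability; a measurable modification changes nothing outside a
  -- null set.
  · obtain ⟨u', v', hu, hv, h', hae⟩ := h.exists_measurable_modification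
    have hae' : ∀ᵐ ω ∂P, (fun t => u t ω) = (fun t => u' t ω) ∧
        (fun t => v t ω) = (fun t => v' t ω) := by
      filter_upwards [hae] with ω hω
      exact ⟨funext fun t => (hω t).1, funext fun t => (hω t).2⟩
    constructor
    · filter_upwards [hae', ae_exists_sfpDone hM hf hg hmn hn hε k l h' hu hv] with ω hω hd
      obtain ⟨T, hT⟩ := hd
      obtain ⟨N, -, hN, hdone, -⟩ := exists_sfpIterations_eq hT
      rw [hω.1, hω.2]
      exact ⟨N, hN, isEpsNash_of_sfpDone hdone⟩
    · refine le_of_eq_of_le (lintegral_congr_ae ?_)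
        (lintegral_sfpIterations_le hM hf hg hmn hn hε k l h' hu hv)
      filter_upwards [hae'] with ω hω
      rw [hω.1, hω.2]
  · obtain ⟨u', v', hu, hv, h', hae⟩ := h.exists_measurable_modification
    have hae' : ∀ᵐ ω ∂P, ∀ r, (fun t => u (r, t) ω) = (fun t => u' (r, t) ω) ∧
        (fun t => v (r, t) ω) = (fun t => v' (r, t) ω) := by
      filter_upwards [hae] with ω hω r
      exact ⟨funext fun t => (hω (r, t)).1, funext fun t => (hω (r, t)).2⟩
    constructor
    · filter_upwards [hae', ae_exists_run_sfpDone hM hf hg hmn hn hε k l h' hu hv] with ω hω hd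
      classical
      -- The first successful run is chosen by its iteration count, not by the guard at the cutoff:
      -- a run may stop earlier even though its unstopped continuation satisfies the guard at the
      -- cutoff.
      have hex : ∃ r, sfpIterations M ε f g k l (fun t => u' (r, t) ω) (fun t => v' (r, t) ω)
          ≤ sfpCutoff n ε := hd.imp fun r hr => sfpIterations_le hr
      simp only [fun r => (hω r).1, fun r => (hω r).2]
      have hr := Nat.find_spec hex
      have hlt := fun s (hs : s < Nat.find hex) => not_le.1 (Nat.find_min hex hs)
      generalize Nat.find hex = r at hr hlt
      obtain ⟨T, hT⟩ : ∃ T, sfpDone M ε (sfpState M f g k l (fun t => u' (r, t) ω)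
          (fun t => v' (r, t) ω) T) := by
        by_contra hcon
        have htop : sfpIterations M ε f g k l (fun t => u' (r, t) ω) (fun t => v' (r, t) ω) = ⊤ :=
          iInf₂_eq_top.2 fun N hN => (hcon ⟨N, hN⟩).elim
        rw [htop] at hr
        exact ENat.natCast_ne_top _ (top_le_iff.1 hr)
      obtain ⟨N, -, hN, hdone, -⟩ := exists_sfpIterations_eq hT
      refine ⟨r, N, hlt, ?_, hN, isEpsNash_of_sfpDone hdone⟩
      rw [hN] at hr
      exact_mod_cast hr
    · refine le_of_eq_of_le (lintegral_congr_ae ?_)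
        (lintegral_restartedIterations_le hM hf hg hmn hn hε k l h' hu hv)
      filter_upwards [hae'] with ω hω
      simp only [fun r => (hω r).1, fun r => (hω r).2]
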